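/- Let $\alpha\in(0,2)$ and consider the one-dimensional wave equation with global constant damping $a\equiv 2\alpha$ and Dirichlet boundary conditions, $$z_{tt}-z_{xx}+2\alpha z_t=0 \ \text{ in } \mathbb R_+\times(0,1),\qquad z(t,0)=z(t,1)=0,\qquad z(0,\cdot)=z_0,\ z_t(0,\cdot)=z_1 .$$ For $p\in[1,\infty]$ let $X_p=W^{1,p}_0(0,1)\times L^p(0,1)$, with $\|(u,v)\|_{X_p}=\big(\tfrac1p\int_0^1(|u'+v|^p+|u'-v|^p)\,dx\big)^{1/p}$ for $p<\infty$ and $\|(u,v)\|_{X_\infty}=\max(\|u'+v\|_{L^\infty},\|u'-v\|_{L^\infty})$. A weak solution with initial state $(z_0,z_1)\in X_p$ is a trajectory $t\mapsto(z(t,\cdot),z_t(t,\cdot))$, $t\ge 0$, bounded in $X_p$, with $z\in C^1([0,\infty);L^1(0,1))$ and time derivative $z_t$, given for $t\ge0$, $x\in[0,1]$ by d'Alembert's formula $$z(t,x)=\tfrac12\big[\tilde z_0(x+t)+\tilde z_0(x-t)\big]+\tfrac12\int_{x-t}^{x+t}\tilde z_1(y)\,dy+\tfrac12\int_0^t\int_{x-(t-s)}^{x+(t-s)}\tilde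 g(s,y)\,dy\,ds,\qquad g=-2\alpha z_t,$$ where the tilde denotes the $2$-periodic extension to $\mathbb R$ of the odd extension to $[-1,1]$ in the space variable. Then, for $p=1$ and for $p=\infty$, every initial state in $X_p$ has exactly one weak solution; the weak solutions define a semigroup $(S(t))_{t\ge0}$ of linear maps of $X_p$ (strongly continuous if $p=1$); and this semigroup is exponentially stable: there are constants $C,\gamma>0$ (depending only on $\alpha$ and $p$) such that $$\|S(t)U\|_{X_p}\le C\,e^{-\gamma t}\,\|U\|_{X_p}\qquad\text{for all } t\ge0,\ U\in X_p .$$ -/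

import Mathlib

open MeasureTheory Filter Topology
open scoped ENNReal NNReal

noncomputable section

namespace DampedWave

/-- Lebesgue measure on the interval `(0,1)`. -/
abbrev μ : Measure ℝ := volume.restrict (Set.Ioo (0 : ℝ) 1)

/-- The Sobolev space `W₀^{1,p}(0,1)`: the functions that are absolutely continuous on `[0,1]`,
vanish at both endpoints, and have an (almost everywhere) derivative in `L^p(0,1)`.
So that equality of elements is equality of functions on `[0,1]`, elements are extended
by zero outside `(0,1)`. -/
def W0 (p : ℝ≥0∞) : Submodule ℝ (ℝ → ℝ) where
  carrier := {u | AbsolutelyContinuousOnInterval u 0 1 ∧ (∀ x, x ∉ Set.Ioo (0 : ℝ) 1 → u x = 0) ∧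
    MemLp (deriv u) p μ}
  zero_mem' := by
    refine ⟨?_, fun x _ => rfl, ?_⟩
    · refine LipschitzOnWith.absolutelyContinuousOnInterval (K := 0) ?_
      intro x _ y _
      simp
    · have h : deriv (0 : ℝ → ℝ) = 0 := by
        funext x
        exact deriv_const x (0 : ℝ)
      rw [h]
      exact MemLp.zero
  add_mem' := by
    rintro u v ⟨hu, hu0, hu'⟩ ⟨hv, hv0, hv'⟩
    refine ⟨hu.add hv, fun x hx => by simp [hu0 x hx, hv0 x hx], ?_⟩
    refine (hu'.add hv').ae_eq ?_
    have h1 := hu.ae_differentiableAt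
    have h2 := hv.ae_differentiableAt
    refine (ae_restrict_iff' measurableSet_Ioo).2 ?_
    filter_upwards [h1, h2] with x hx1 hx2 hx
    have hx' : x ∈ Set.uIcc (0 : ℝ) 1 := by
      rw [Set.uIcc_of_le zero_le_one]
      exact Set.Ioo_subset_Icc_self hx
    rw [deriv_add (hx1 hx') (hx2 hx')]
    rfl
  smul_mem' := by
    rintro c u ⟨hu, hu0, hu'⟩
    refine ⟨hu.const_mul c, fun x hx => by simp [hu0 x hx], ?_⟩
    have h : deriv (c • u) = c • deriv u := by
      funext x
      exact deriv_const_smul_field c u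
    rw [h]
    exact hu'.const_smul c

/-- The state space `X_p = W₀^{1,p}(0,1) × L^p(0,1)`. -/
abbrev X (p : ℝ≥0∞) : Type := W0 p × Lp ℝ p μ

variable {p : ℝ≥0∞}

/-- The first component `u` of a state `(u, v)`, as a function. -/
def X.pos (U : X p) : ℝ → ℝ := (U.1 : ℝ → ℝ)

/-- The second component `v` of a state `(u, v)`, as a function defined almost everywhere
on `(0,1)`. -/
def X.vel (U : X p) : ℝ → ℝ := (U.2 : ℝ → ℝ)

/-- The Riemann invariant `ρ = u' + v` of a state. -/
def X.rho (U : X p) (x : ℝ) : ℝ := deriv (X.pos U) x + X.vel U x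

/-- The Riemann invariant `ξ = u' - v` of a state. -/
def X.xi (U : X p) (x : ℝ) : ℝ := deriv (X.pos U) x - X.vel U x

/-- The norm of `X_p`: `((1/p) ∫₀¹ (|u' + v|^p + |u' - v|^p) dx)^(1/p)` for finite `p`, and
`max (‖u' + v‖_∞, ‖u' - v‖_∞)`, its limit as `p → ∞`, for `p = ∞`. -/
def Xnorm (U : X p) : ℝ :=
  if p = ∞ then
    max (eLpNorm (X.rho U) ∞ μ).toReal (eLpNorm (X.xi U) ∞ μ).toReal
  else
    ((1 / p.toReal) * ∫ x in Set.Ioo (0 : ℝ) 1,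
      (|X.rho U x| ^ p.toReal + |X.xi U x| ^ p.toReal)) ^ (1 / p.toReal)

/-- The `2`-periodic extension to `ℝ` of the odd extension to `[-1,1]` of a function
on `[0,1]`. -/
def oddExt (f : ℝ → ℝ) (x : ℝ) : ℝ :=
  let y := x - 2 * (⌊(x + 1) / 2⌋ : ℝ)
  if 0 ≤ y then f y else -f (-y)

/-- `IsWeakSolution a U₀ Z`: the trajectory `Z t = (z(t,·), z_t(t,·))` in `X_p` is the weak
solution of `z_tt - z_xx + a(x) z_t = 0` on `ℝ₊ × (0,1)`, `z(t,0) = z(t,1) = 0`, with initial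
state `U₀ = (z₀, z₁)`. -/
structure IsWeakSolution (a : ℝ → ℝ) (U₀ : X p) (Z : ℝ≥0 → X p) : Prop where
  /-- `z ∈ L^∞(ℝ₊, W₀^{1,p})` and `z_t ∈ L^∞(ℝ₊, L^p)`. -/
  bounded : ∃ M : ℝ, ∀ t, Xnorm (Z t) ≤ M
  /-- The second component of `Z t` is the time derivative of the first one, at every time;
  the derivative is taken in `L^1(0,1)`, which contains all the spaces `L^p(0,1)`. -/
  hasDeriv : ∀ t : ℝ≥0, Tendsto (fun s : ℝ≥0 => eLpNorm (fun x =>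
    (X.pos (Z s) x - X.pos (Z t) x) / ((s : ℝ) - (t : ℝ)) - X.vel (Z t) x) 1 μ) (𝓝[≠] t) (𝓝 0)
  /-- `z_t` is continuous in time with values in `L^1(0,1)`. -/
  continuous_vel : ∀ t : ℝ≥0, Tendsto (fun s : ℝ≥0 => eLpNorm (fun x =>
    X.vel (Z s) x - X.vel (Z t) x) 1 μ) (𝓝 t) (𝓝 0)
  /-- `z` is given by d'Alembert's formula with source term `-a(x) z_t`. -/
  dalembert : ∀ t : ℝ≥0, ∀ x ∈ Set.Icc (0 : ℝ) 1,
    X.pos (Z t) x =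
      (1 / 2) * (oddExt (X.pos U₀) (x + t) + oddExt (X.pos U₀) (x - t))
      + (1 / 2) * (∫ y in (x - t)..(x + t), oddExt (X.vel U₀) y)
      + (1 / 2) * (∫ s in (0 : ℝ)..t, ∫ y in (x - (t - s))..(x + (t - s)),
          oddExt (fun r => -(a r * X.vel (Z s.toNNReal) r)) y)

/-- `S` is the semigroup on `X_p` of the weak solutions of the damped wave equation: it is a
one-parameter semigroup of linear maps, `t ↦ S t U₀` is the one and only weak solution with
initial state `U₀`, and, for finite `p`, it is strongly continuous. -/
structure IsWaveSemigroup (a : ℝ → ℝ) (S : ℝ≥0 → (X p →ₗ[ℝ] X p)) : Prop where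
  zero : S 0 = LinearMap.id
  add : ∀ s t, S (s + t) = S s ∘ₗ S t
  solution_iff : ∀ (U₀ : X p) (Z : ℝ≥0 → X p), IsWeakSolution a U₀ Z ↔ Z = fun t => S t U₀
  strongly_continuous : p ≠ ∞ → ∀ (U₀ : X p) (t : ℝ≥0),
    Tendsto (fun s => Xnorm (S s U₀ - S t U₀)) (𝓝 t) (𝓝 0)

/-- Exponential stability: `‖S(t)U‖ ≤ C e^{-γt} ‖U‖` for all `t ≥ 0` and all states `U`. -/
def IsExponentiallyStable (S : ℝ≥0 → (X p →ₗ[ℝ] X p)) : Prop :=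
  ∃ C γ : ℝ, 0 < C ∧ 0 < γ ∧ ∀ (t : ℝ≥0) (U : X p),
    Xnorm (S t U) ≤ C * Real.exp (-γ * t) * Xnorm U

end DampedWave

end

open MeasureTheory Filter Topology
open scoped ENNReal NNReal

noncomputable section

namespace DampedWave

/-! For a state `(u, v)` put `u' + v` at `x` and `u' - v` at `-x`, for `x` in `(0,1)`. This gives an
integrable function `f` on the circle of length `2` (`enc`). Its even part is `u'`, its odd part is
`v`, and `u(1) = 0` says that `f` has mean zero. The damped wave equation becomes `f_t = f_x + α
(refl f - f)`.

Writing `f(t) = e^{-αt} tr t (σ(t))` removes transport and decay and leaves `σ' = α refl (tr (2t)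
σ)`, solved by a series (`sol`) whose `n`-th term is bounded by `(αt)^n / n!` times the initial
bound. The sum `e^{αt}` is cancelled by the prefactor, so the evolution is a contraction. At `t = 1`
the first-order term is `α refl` of half the integral of the translates of `f` over a full period,
which vanishes because `f` has mean zero (`picard_one_of_mean_eq_zero`). The bound therefore drops
by the factor `(e^α - α) e^{-α} = 1 - α e^{-α} < 1` in one unit of time. The mean stays zero, so
this iterates to exponential decay (`exists_decay`).

These estimates only use that the bound respects translations, reflection, scaling, integrals and
series. `IsGauge` records this, so that `L^1` norms and `L^∞` bounds are treated together.
Translations are not strongly continuous on `L^∞`, so all integrals and series live in `L^1` and the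
`L^∞` bound is carried along.

Weak solutions correspond to this evolution (`isWeakSolution_iff`): d'Alembert's formula determines
the even part of the state, and `z_t` being the time derivative of `z` determines the odd part.
Together they give a Duhamel equation, equivalent to the equation for `σ`, which has unique
solutions. -/

/-! ### The circle of length `2`: measure, translations, reflection, restriction to `(0,1)`. -/

instance fact_two_pos : Fact ((0 : ℝ) < 2) := ⟨two_pos⟩

/-- The circle of length `2`. -/
abbrev Circ : Type := AddCircle (2 : ℝ)

/-- Integrable functions on the circle of length `2`. -/
abbrev E : Type := Lp ℝ 1 (volume : Measure Circ)

/-- Integrable functions on `(0,1)`. -/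
abbrev F : Type := Lp ℝ 1 μ

/-- Up to null sets the circle is `(0,1)` together with its mirror image. Norms and
almost-everywhere statements on the circle thus split into two statements on `(0,1)`. -/
lemma volume_circ_eq : (volume : Measure Circ) =
    μ.map (fun y : ℝ => (y : Circ)) + μ.map (fun y : ℝ => ((-y : ℝ) : Circ)) := by
  have h1 : Measurable (fun y : ℝ => (y : Circ)) := AddCircle.measurable_mk'
  have h2 : Measurable (fun y : ℝ => ((-y : ℝ) : Circ)) := h1.comp measurable_neg
  have key : (volume.restrict (Set.Ioc (-1 : ℝ) 1)) = μ + μ.map (fun y : ℝ => -y) := by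
    have e1 : μ.map (fun y : ℝ => -y) = volume.restrict (Set.Ioo (-1 : ℝ) 0) := by
      have := (Measure.measurePreserving_neg (volume : Measure ℝ)).restrict_preimage
        (s := Set.Ioo (-1 : ℝ) 0) measurableSet_Ioo
      have h := this.map_eq
      simpa using h
    rw [e1, add_comm, ← Set.Ioc_union_Ioc_eq_Ioc (b := (0 : ℝ)) (by norm_num) (by norm_num),
      Measure.restrict_union (Set.disjoint_left.2 fun x hx hx' => absurd hx.2 (not_le.2 hx'.1))
        measurableSet_Ioc, Measure.restrict_congr_set Ioo_ae_eq_Ioc,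
      ← Measure.restrict_congr_set (Ioo_ae_eq_Ioc (a := (0 : ℝ)) (b := 1))]
  have h := (AddCircle.measurePreserving_mk (2 : ℝ) (-1)).map_eq
  rw [show (-1 : ℝ) + 2 = 1 by norm_num, key, Measure.map_add _ _ h1,
    Measure.map_map h1 measurable_neg] at h
  exact h.symm

lemma measurable_coe_circ : Measurable (fun y : ℝ => (y : Circ)) := AddCircle.measurable_mk'

lemma measurable_coe_neg_circ : Measurable (fun y : ℝ => ((-y : ℝ) : Circ)) :=
  measurable_coe_circ.comp measurable_neg

lemma ae_circ_iff {P : Circ → Prop} (hP : MeasurableSet {x | P x}) :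
    (∀ᵐ x : Circ, P x) ↔ (∀ᵐ y ∂μ, P (y : ℝ)) ∧ ∀ᵐ y ∂μ, P ((-y : ℝ)) := by
  rw [volume_circ_eq, ae_add_measure_iff, ae_map_iff measurable_coe_circ.aemeasurable hP,
    ae_map_iff measurable_coe_neg_circ.aemeasurable hP]

lemma lintegral_circ {g : Circ → ℝ≥0∞} (hg : Measurable g) :
    ∫⁻ x : Circ, g x = (∫⁻ y, g (y : ℝ) ∂μ) + ∫⁻ y, g ((-y : ℝ)) ∂μ := by
  rw [volume_circ_eq, lintegral_add_measure, lintegral_map hg measurable_coe_circ,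
    lintegral_map hg measurable_coe_neg_circ]

lemma quasiMeasurePreserving_coe : Measure.QuasiMeasurePreserving (fun y : ℝ => (y : Circ))
    (volume : Measure ℝ) volume := by
  refine ⟨measurable_coe_circ, Measure.AbsolutelyContinuous.mk fun s hs h0 => ?_⟩
  rw [Measure.map_apply measurable_coe_circ hs]
  have h : ∀ n : ℤ, volume (((fun y : ℝ => (y : Circ)) ⁻¹' s) ∩ Set.Ioc ((2 * n : ℤ) : ℝ) ((2 * n : ℤ) + 2)) = 0 := by
    intro n
    have := AddCircle.add_projection_respects_measure (2 : ℝ) ((2 * n : ℤ) : ℝ) hs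
    rw [h0] at this
    exact this.symm
  refine measure_mono_null ?_ (measure_iUnion_null h)
  intro x hx
  obtain ⟨n, hn, -⟩ := existsUnique_add_zsmul_mem_Ioc (two_pos : (0 : ℝ) < 2) x 0
  refine Set.mem_iUnion.2 ⟨-n, hx, ?_⟩
  simp only [Set.mem_Ioc, zsmul_eq_mul] at hn ⊢
  push_cast
  constructor <;> linarith [hn.1, hn.2]

lemma quasiMeasurePreserving_coe_Ioo : Measure.QuasiMeasurePreserving (fun y : ℝ => (y : Circ))
    μ volume :=
  quasiMeasurePreserving_coe.mono_left Measure.restrict_le_self.absolutelyContinuous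

/-- Translation on the circle. -/
def tr (t : ℝ) : E →L[ℝ] E :=
  (Lp.compMeasurePreservingₗᵢ ℝ (fun x : Circ => x + (t : Circ))
    (measurePreserving_add_right volume (t : Circ))).toContinuousLinearMap

/-- Reflection on the circle. -/
def refl : E →L[ℝ] E :=
  (Lp.compMeasurePreservingₗᵢ ℝ (fun x : Circ => -x)
    (Measure.measurePreserving_neg volume)).toContinuousLinearMap

lemma coeFn_tr (t : ℝ) (f : E) : tr t f =ᵐ[volume] fun x => f (x + (t : Circ)) :=
  Lp.coeFn_compMeasurePreserving f (measurePreserving_add_right volume (t : Circ))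

lemma coeFn_refl (f : E) : refl f =ᵐ[volume] fun x => f (-x) :=
  Lp.coeFn_compMeasurePreserving f (Measure.measurePreserving_neg volume)

@[simp] lemma norm_tr (t : ℝ) (f : E) : ‖tr t f‖ = ‖f‖ :=
  Lp.norm_compMeasurePreserving f _

@[simp] lemma norm_refl (f : E) : ‖refl f‖ = ‖f‖ :=
  Lp.norm_compMeasurePreserving f _

lemma tr_tr (s t : ℝ) (f : E) : tr s (tr t f) = tr (s + t) f := by
  refine Lp.ext ?_
  filter_upwards [coeFn_tr s (tr t f), coeFn_tr (s + t) f,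
    (measurePreserving_add_right volume (s : Circ)).quasiMeasurePreserving.ae (coeFn_tr t f)]
    with x h1 h2 h3
  rw [h1, h2, h3, AddCircle.coe_add, add_assoc]

@[simp] lemma tr_zero (f : E) : tr 0 f = f := by
  refine Lp.ext ?_
  filter_upwards [coeFn_tr 0 f] with x h1
  rw [h1, AddCircle.coe_zero, add_zero]

@[simp] lemma refl_refl (f : E) : refl (refl f) = f := by
  refine Lp.ext ?_
  filter_upwards [coeFn_refl (refl f),
    (Measure.measurePreserving_neg (volume : Measure Circ)).quasiMeasurePreserving.ae (coeFn_refl f)]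
    with x h1 h2
  rw [h1, h2, neg_neg]

lemma refl_tr (t : ℝ) (f : E) : refl (tr t f) = tr (-t) (refl f) := by
  refine Lp.ext ?_
  filter_upwards [coeFn_refl (tr t f), coeFn_tr (-t) (refl f),
    (Measure.measurePreserving_neg (volume : Measure Circ)).quasiMeasurePreserving.ae (coeFn_tr t f),
    (measurePreserving_add_right volume ((-t : ℝ) : Circ)).quasiMeasurePreserving.ae
      (coeFn_refl f)] with x h1 h2 h3 h4
  rw [h1, h2, h3, h4, AddCircle.coe_neg, neg_add, neg_neg]

lemma continuous_tr : Continuous fun q : ℝ × E => tr q.1 q.2 := by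
  refine Continuous.compMeasurePreservingLp (p := 1) (f := fun q : ℝ × E => q.2)
    (g := fun q : ℝ × E => ⟨fun x : Circ => x + (q.1 : Circ), continuous_add_const _⟩)
    continuous_snd ?_ (fun q => measurePreserving_add_right volume (q.1 : Circ)) (by simp)
  refine ContinuousMap.continuous_of_continuous_uncurry _ ?_
  exact continuous_snd.add ((AddCircle.continuous_mk' 2).comp (continuous_fst.comp continuous_fst))

lemma Continuous.tr {Y : Type*} [TopologicalSpace Y] {a : Y → ℝ} {g : Y → E}
    (ha : Continuous a) (hg : Continuous g) : Continuous fun y => tr (a y) (g y) :=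
  continuous_tr.comp (ha.prodMk hg)

lemma memLp_restrict (f : E) : MemLp (fun y : ℝ => f (y : Circ)) 1 μ := by
  have h := (Lp.memLp f).comp_measurePreserving (AddCircle.measurePreserving_mk (2 : ℝ) (-1))
  refine h.mono_measure (Measure.restrict_mono ?_ le_rfl)
  intro x hx
  exact ⟨by linarith [hx.1], by linarith [hx.2]⟩

lemma enorm_split (f : E) : eLpNorm f 1 volume = eLpNorm (fun y : ℝ => f (y : Circ)) 1 μ +
    eLpNorm (fun y : ℝ => f ((-y : ℝ) : Circ)) 1 μ := by
  simp only [eLpNorm_one_eq_lintegral_enorm]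
  exact lintegral_circ (Lp.stronglyMeasurable f).measurable.enorm

/-- Restriction of functions on the circle to `(0,1)`. -/
def restr : E →L[ℝ] F :=
  LinearMap.mkContinuous
    { toFun := fun f => (memLp_restrict f).toLp _
      map_add' := fun f g => by
        refine Lp.ext ?_
        filter_upwards [(memLp_restrict (f + g)).coeFn_toLp, (memLp_restrict f).coeFn_toLp,
          (memLp_restrict g).coeFn_toLp, Lp.coeFn_add ((memLp_restrict f).toLp _)
            ((memLp_restrict g).toLp _),
          quasiMeasurePreserving_coe_Ioo.ae (Lp.coeFn_add f g)] with y h1 h2 h3 h4 h5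
        rw [h1, h4, Pi.add_apply, h2, h3, h5, Pi.add_apply]
      map_smul' := fun c f => by
        refine Lp.ext ?_
        filter_upwards [(memLp_restrict (c • f)).coeFn_toLp, (memLp_restrict f).coeFn_toLp,
          Lp.coeFn_smul c ((memLp_restrict f).toLp _),
          quasiMeasurePreserving_coe_Ioo.ae (Lp.coeFn_smul c f)] with y h1 h2 h4 h5
        rw [h1, RingHom.id_apply, h4, Pi.smul_apply, h2, h5, Pi.smul_apply] } 1
    (fun f => by
      simp only [LinearMap.coe_mk, AddHom.coe_mk, one_mul]
      rw [Lp.norm_toLp, Lp.norm_def, enorm_split]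
      refine ENNReal.toReal_mono ?_ le_self_add
      rw [← enorm_split]
      exact (Lp.memLp f).2.ne)

lemma coeFn_restr (f : E) : restr f =ᵐ[μ] fun y => f (y : Circ) :=
  (memLp_restrict f).coeFn_toLp

lemma coeFn_restr_refl (f : E) : restr (refl f) =ᵐ[μ] fun y => f ((-y : ℝ) : Circ) := by
  filter_upwards [coeFn_restr (refl f), quasiMeasurePreserving_coe_Ioo.ae (coeFn_refl f)]
    with y h1 h2
  rw [h1, h2, AddCircle.coe_neg]

lemma norm_split (f : E) : ‖f‖ = ‖restr f‖ + ‖restr (refl f)‖ := by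
  rw [Lp.norm_def, Lp.norm_def, Lp.norm_def, enorm_split, eLpNorm_congr_ae (coeFn_restr f),
    eLpNorm_congr_ae (coeFn_restr_refl f), ENNReal.toReal_add]
  · exact (memLp_restrict f).2.ne
  · rw [← eLpNorm_congr_ae (coeFn_restr_refl f)]
    exact (Lp.memLp _).2.ne

lemma ext_restr {f g : E} (h1 : restr f = restr g) (h2 : restr (refl f) = restr (refl g)) :
    f = g := by
  rw [← sub_eq_zero, ← norm_eq_zero, norm_split, map_sub, map_sub, map_sub, h1, h2]
  simp

lemma exists_restr_eq (a b : F) : ∃ f : E, restr f = a ∧ restr (refl f) = b := by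
  -- The representative in `(-1, 1]`; its sign decides which of the two functions is used.
  let y : Circ → ℝ := fun x => (AddCircle.measurableEquivIoc 2 (-1) x : ℝ)
  have hy : Measurable y := measurable_subtype_coe.comp (AddCircle.measurableEquivIoc 2 (-1)).measurable
  have hyc : ∀ r : ℝ, r ∈ Set.Ioc (-1 : ℝ) 1 → y (r : Circ) = r := fun r hr => by
    have : r ∈ Set.Ioc (-1 : ℝ) (-1 + 2) := ⟨hr.1, by linarith [hr.2]⟩
    exact congrArg Subtype.val (AddCircle.equivIoc_coe_eq this)
  let g : Circ → ℝ := fun x => if 0 < y x then a (y x) else b (-y x)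
  have hg : Measurable g := Measurable.ite (measurableSet_lt measurable_const hy)
    ((Lp.stronglyMeasurable a).measurable.comp hy)
    ((Lp.stronglyMeasurable b).measurable.comp hy.neg)
  have e1 : (fun r : ℝ => g (r : Circ)) =ᵐ[μ] a := by
    refine (ae_restrict_iff' measurableSet_Ioo).2 (.of_forall fun r hr => ?_)
    have := hyc r ⟨by linarith [hr.1], hr.2.le⟩
    simp only [g, this, if_pos hr.1]
  have e2 : (fun r : ℝ => g ((-r : ℝ) : Circ)) =ᵐ[μ] b := by
    refine (ae_restrict_iff' measurableSet_Ioo).2 (.of_forall fun r hr => ?_)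
    have := hyc (-r) ⟨by linarith [hr.2], by linarith [hr.1]⟩
    simp only [g, this]
    rw [if_neg (by linarith [hr.1]), neg_neg]
  have hm : MemLp g 1 (volume : Measure Circ) := by
    refine ⟨hg.aestronglyMeasurable, ?_⟩
    rw [eLpNorm_one_eq_lintegral_enorm, lintegral_circ hg.enorm,
      ← eLpNorm_one_eq_lintegral_enorm (f := fun r : ℝ => g (r : Circ)),
      ← eLpNorm_one_eq_lintegral_enorm (f := fun r : ℝ => g ((-r : ℝ) : Circ)),
      eLpNorm_congr_ae e1, eLpNorm_congr_ae e2]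
    exact ENNReal.add_lt_top.2 ⟨(Lp.memLp a).2, (Lp.memLp b).2⟩
  have hn : Measure.QuasiMeasurePreserving (fun y : ℝ => ((-y : ℝ) : Circ)) μ volume :=
    (quasiMeasurePreserving_coe.comp
      (Measure.measurePreserving_neg (volume : Measure ℝ)).quasiMeasurePreserving).mono_left
      Measure.restrict_le_self.absolutelyContinuous
  refine ⟨hm.toLp g, Lp.ext ?_, Lp.ext ?_⟩
  · filter_upwards [coeFn_restr (hm.toLp g), quasiMeasurePreserving_coe_Ioo.ae hm.coeFn_toLp, e1]
      with r h1 h2 h3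
    rw [h1, h2, h3]
  · filter_upwards [coeFn_restr_refl (hm.toLp g), hn.ae hm.coeFn_toLp, e2] with r h1 h2 h3
    rw [h1, h2, h3]


/-! ### Set integrals, the mean, and averages of translates. -/

/-- Integration over a set, as a continuous linear form on `E`. -/
def setInt (s : Set Circ) : E →L[ℝ] ℝ where
  toFun f := ∫ x in s, f x
  map_add' f g := by
    rw [← integral_add (L1.integrable_coeFn f).integrableOn (L1.integrable_coeFn g).integrableOn]
    exact integral_congr_ae (ae_restrict_of_ae (Lp.coeFn_add f g))
  map_smul' c f := by
    rw [RingHom.id_apply, ← integral_smul]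
    exact integral_congr_ae (ae_restrict_of_ae (Lp.coeFn_smul c f))
  cont := continuous_setIntegral s

lemma setInt_apply (s : Set Circ) (f : E) : setInt s f = ∫ x in s, f x := rfl

lemma setInt_tr (s : Set Circ) (t : ℝ) (f : E) :
    setInt s (tr t f) = setInt ((fun x : Circ => x + ((-t : ℝ) : Circ)) ⁻¹' s) f := by
  rw [setInt_apply, setInt_apply, integral_congr_ae (ae_restrict_of_ae (coeFn_tr t f))]
  rw [← (measurePreserving_add_right volume (t : Circ)).setIntegral_preimage_emb
    (measurableEmbedding_addRight (t : Circ)) f ((fun x : Circ => x + ((-t : ℝ) : Circ)) ⁻¹' s)]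
  congr 2
  ext x
  simp

lemma setInt_refl (s : Set Circ) (f : E) :
    setInt s (refl f) = setInt ((fun x : Circ => -x) ⁻¹' s) f := by
  rw [setInt_apply, setInt_apply, integral_congr_ae (ae_restrict_of_ae (coeFn_refl f))]
  rw [← (Measure.measurePreserving_neg (volume : Measure Circ)).setIntegral_preimage_emb
    (MeasurableEquiv.neg Circ).measurableEmbedding f ((fun x : Circ => -x) ⁻¹' s)]
  congr 2
  ext x
  simp

/-- The integral over the circle. -/
abbrev mean : E →L[ℝ] ℝ := setInt Set.univ

lemma mean_tr (t : ℝ) (f : E) : mean (tr t f) = mean f := setInt_tr _ _ _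

lemma mean_refl (f : E) : mean (refl f) = mean f := setInt_refl _ _

/-- Bochner integrals of translates are pointwise integrals. -/
lemma coeFn_integral_tr (f : E) (ν : Measure ℝ) [IsFiniteMeasure ν] :
    ((∫ r, tr r f ∂ν : E) : Circ → ℝ) =ᵐ[volume] fun x => ∫ r, f (x + (r : Circ)) ∂ν := by
  have hf : StronglyMeasurable (f : Circ → ℝ) := Lp.stronglyMeasurable f
  have hmeas : Measurable (fun q : Circ × ℝ => q.1 + (q.2 : Circ)) :=
    measurable_fst.add (measurable_coe_circ.comp measurable_snd)
  have hint : Integrable (fun q : Circ × ℝ => f (q.1 + (q.2 : Circ))) (volume.prod ν) := by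
    have hms : AEStronglyMeasurable (fun q : Circ × ℝ => f (q.1 + (q.2 : Circ)))
        (volume.prod ν) := (hf.comp_measurable hmeas).aestronglyMeasurable
    rw [integrable_prod_iff' hms]
    constructor
    · exact .of_forall fun r => ((measurePreserving_add_right volume (r : Circ)).integrable_comp
        hf.aestronglyMeasurable).2 (L1.integrable_coeFn f)
    · have : ∀ r : ℝ, ∫ x : Circ, ‖f (x + (r : Circ))‖ = ∫ x : Circ, ‖f x‖ := fun r =>
        integral_add_right_eq_self (fun x => ‖f x‖) (r : Circ)
      simp only [this]
      exact integrable_const _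
  have htr : Integrable (fun r => tr r f) ν :=
    Integrable.of_bound (Continuous.tr continuous_id continuous_const).aestronglyMeasurable ‖f‖
      (.of_forall fun r => by simp)
  -- Set integrals determine an integrable function. They commute with the Bochner integral, after
  -- which the claim is Fubini.
  refine Integrable.ae_eq_of_forall_setIntegral_eq _ _ (L1.integrable_coeFn _)
    hint.integral_prod_left fun s hs _ => ?_
  rw [← setInt_apply, ← ContinuousLinearMap.integral_comp_comm _ htr]
  have h2 : ∀ r, setInt s (tr r f) = ∫ x in s, f (x + (r : Circ)) := fun r =>
    integral_congr_ae (ae_restrict_of_ae (coeFn_tr r f))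
  simp only [h2]
  refine (integral_integral_swap ?_).symm
  refine hint.mono_measure ?_
  exact Measure.prod_mono Measure.restrict_le_self le_rfl

lemma coeFn_intervalIntegral_tr (f : E) (h : ℝ) :
    ((∫ r in (0 : ℝ)..h, tr r f : E) : Circ → ℝ) =ᵐ[volume]
      fun x => ∫ r in (0 : ℝ)..h, f (x + (r : Circ)) := by
  have : IsFiniteMeasure (volume.restrict (Set.uIoc 0 h)) := by
    rw [Set.uIoc]
    infer_instance
  have h0 := coeFn_integral_tr f (volume.restrict (Set.uIoc 0 h))
  simp only [intervalIntegral.intervalIntegral_eq_integral_uIoc]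
  filter_upwards [h0, Lp.coeFn_smul (if (0 : ℝ) ≤ h then (1 : ℝ) else -1)
    (∫ r in Set.uIoc 0 h, tr r f : E)] with x h1 h2
  rw [h2, Pi.smul_apply, h1]

lemma integral_tr_period {f : E} (hf : mean f = 0) : ∫ r in (0 : ℝ)..2, tr r f = 0 := by
  refine Lp.ext ?_
  filter_upwards [coeFn_intervalIntegral_tr f 2, Lp.coeFn_zero ℝ 1 (volume : Measure Circ)]
    with x h1 h2
  have h3 := AddCircle.intervalIntegral_preimage (2 : ℝ) 0 (fun z : Circ => f (x + z))
  rw [zero_add] at h3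
  rw [h1, h2, h3, integral_add_left_eq_self (fun z => f z) x, Pi.zero_apply, ← hf, mean,
    setInt_apply, setIntegral_univ]

/-! ### Gauges: bounds that survive integrals and series. -/

/-- A family of convex conditions `G c` on integrable functions, homogeneous in `c` and invariant
under the symmetries of the circle. -/
structure IsGauge (G : ℝ → E → Prop) : Prop where
  tr : ∀ {c f} (t : ℝ), G c f → G c (tr t f)
  refl : ∀ {c f}, G c f → G c (refl f)
  smul : ∀ {c f a}, 0 ≤ a → G c f → G (a * c) (a • f)
  integral : ∀ {t : ℝ} {c : ℝ → ℝ} {g : ℝ → E}, 0 ≤ t → Continuous c → Continuous g →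
    (∀ s, 0 ≤ s → G (c s) (g s)) → G (∫ s in (0 : ℝ)..t, c s) (∫ s in (0 : ℝ)..t, g s)
  hasSum : ∀ {c : ℕ → ℝ} {f : ℕ → E} {C f₀}, HasSum c C → HasSum f f₀ →
    (∀ n, G (c n) (f n)) → G C f₀

/-- Continuous linear maps commute with integrals and sums in `L^1`, so a bound expressed through
such maps passes to both by the triangle inequality. Only the two symmetries have to be checked case
by case. -/
lemma isGauge_of_family {ι V : Type*} [NormedAddCommGroup V] [NormedSpace ℝ V] [CompleteSpace V]
    (φ : ι → E →L[ℝ] V) (w : ι → ℝ)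
    (htr : ∀ c f t, (∀ i, ‖φ i f‖ ≤ c * w i) → ∀ i, ‖φ i (tr t f)‖ ≤ c * w i)
    (hrefl : ∀ c f, (∀ i, ‖φ i f‖ ≤ c * w i) → ∀ i, ‖φ i (refl f)‖ ≤ c * w i) :
    IsGauge fun c f => ∀ i, ‖φ i f‖ ≤ c * w i where
  tr t h := htr _ _ t h
  refl h := hrefl _ _ h
  smul {c f a} ha h i := by
    rw [map_smul, norm_smul, Real.norm_of_nonneg ha, mul_assoc]
    exact mul_le_mul_of_nonneg_left (h i) ha
  integral {t c g} ht hc hg h i := by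
    rw [← ContinuousLinearMap.intervalIntegral_comp_comm _ (hg.intervalIntegrable _ _),
      ← intervalIntegral.integral_mul_const]
    refine (intervalIntegral.norm_integral_le_integral_norm ht).trans ?_
    refine intervalIntegral.integral_mono_on ht ?_ ?_ fun s hs => h s hs.1 i
    · exact (((φ i).continuous.comp hg).norm).intervalIntegrable _ _
    · exact (hc.mul_const _).intervalIntegrable _ _
  hasSum {c f C f₀} hc hf h i := by
    have h1 := hf.mapL (φ i)
    rw [← h1.tsum_eq]
    exact tsum_of_norm_bounded (hc.mul_right (w i)) fun n => h n i

lemma isGauge_norm : IsGauge fun c f => ‖f‖ ≤ c := by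
  have := isGauge_of_family (fun _ : Unit => ContinuousLinearMap.id ℝ E) (fun _ => 1)
    (fun c f t h i => by simpa using h i) (fun c f h i => by simpa using h i)
  simpa using this

lemma isGauge_mean : IsGauge fun _ f => mean f = 0 := by
  have := isGauge_of_family (fun _ : Unit => mean) (fun _ => 0)
    (fun c f t h i => by simpa [mean_tr] using h i) (fun c f h i => by simpa [mean_refl] using h i)
  simpa using this

/-- Turns a pointwise bound, which `L^1`-continuous maps do not see directly, into a family of
bounds on continuous linear forms, as `isGauge_of_family` requires. -/
lemma ae_bdd_iff (c : ℝ) (f : E) : (∀ᵐ x, |f x| ≤ c) ↔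
    ∀ s : {s : Set Circ // MeasurableSet s}, ‖setInt s.1 f‖ ≤ c * volume.real s.1 := by
  constructor
  · rintro h ⟨s, hs⟩
    rw [setInt_apply]
    exact norm_setIntegral_le_of_norm_le_const_ae' (measure_lt_top _ _)
      (h.mono fun x hx _ => hx)
  · intro h
    have hfi := L1.integrable_coeFn f
    have h1 : (f : Circ → ℝ) ≤ᵐ[volume] fun _ => c := by
      refine ae_le_of_forall_setIntegral_le hfi (integrable_const c) fun s hs _ => ?_
      rw [setIntegral_const, smul_eq_mul, mul_comm]
      exact (le_abs_self _).trans (h ⟨s, hs⟩)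
    have h2 : (fun _ => -c) ≤ᵐ[volume] (f : Circ → ℝ) := by
      refine ae_le_of_forall_setIntegral_le (integrable_const _) hfi fun s hs _ => ?_
      rw [setIntegral_const, smul_eq_mul, mul_comm]
      have := (neg_abs_le (setInt s f)).trans' (neg_le_neg (h ⟨s, hs⟩))
      rwa [← neg_mul] at this
    filter_upwards [h1, h2] with x hx1 hx2
    exact abs_le.2 ⟨hx2, hx1⟩

lemma isGauge_bdd : IsGauge fun c f => ∀ᵐ x, |f x| ≤ c := by
  simp only [ae_bdd_iff]
  refine isGauge_of_family _ _ (fun c f t h => ?_) (fun c f h => ?_)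
  · rw [← ae_bdd_iff] at h ⊢
    filter_upwards [coeFn_tr t f,
      (measurePreserving_add_right volume (t : Circ)).quasiMeasurePreserving.ae h] with x h1 h2
    rwa [h1]
  · rw [← ae_bdd_iff] at h ⊢
    filter_upwards [coeFn_refl f,
      (Measure.measurePreserving_neg (volume : Measure Circ)).quasiMeasurePreserving.ae h]
      with x h1 h2
    rwa [h1]

/-! ### The series solution of the equation for `σ`, and its uniqueness. -/

/-- The iterates of the integral equation `σ(t) = f + α ∫₀ᵗ refl (tr (2 s) (σ s)) ds`. -/
def picard (α : ℝ) (f : E) : ℕ → ℝ → E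
  | 0 => fun _ => f
  | n + 1 => fun t => α • ∫ s in (0 : ℝ)..t, refl (tr (2 * s) (picard α f n s))

variable {α : ℝ} {f : E}

lemma continuous_picard (n : ℕ) : Continuous (picard α f n) := by
  induction n with
  | zero => exact continuous_const
  | succ n ih =>
    refine Continuous.const_smul ?_ α
    refine intervalIntegral.continuous_primitive (fun a b => Continuous.intervalIntegrable ?_ a b) 0
    exact refl.continuous.comp (Continuous.tr (continuous_const.mul continuous_id) ih)

lemma continuous_refl_tr {g : ℝ → E} (hg : Continuous g) :
    Continuous fun s => refl (tr (2 * s) (g s)) :=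
  refl.continuous.comp (Continuous.tr (continuous_const.mul continuous_id) hg)

lemma hasDerivAt_picard_succ (n : ℕ) (t : ℝ) :
    HasDerivAt (picard α f (n + 1)) (α • refl (tr (2 * t) (picard α f n t))) t :=
  HasDerivAt.const_smul α
    ((continuous_refl_tr (continuous_picard n)).integral_hasStrictDerivAt 0 t).hasDerivAt

/-- Negative times are included so that the sum has a two-sided derivative at `t = 0`. -/
lemma norm_picard_le (hα : 0 ≤ α) (n : ℕ) (t : ℝ) :
    ‖picard α f n t‖ ≤ (α * |t|) ^ n / n.factorial * ‖f‖ := by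
  induction n generalizing t with
  | zero => simp [picard]
  | succ n ih =>
    rw [picard, norm_smul, Real.norm_of_nonneg hα]
    have h1 : ‖∫ s in (0 : ℝ)..t, refl (tr (2 * s) (picard α f n s))‖ ≤
        |∫ s in Set.uIoc 0 t, α ^ n / n.factorial * ‖f‖ * |s - 0| ^ n| := by
      rw [intervalIntegral.norm_intervalIntegral_eq]
      refine (norm_integral_le_of_norm_le (Continuous.integrableOn_uIoc (by fun_prop))
        (.of_forall fun s => ?_)).trans (le_abs_self _)
      rw [norm_refl, norm_tr]
      refine (ih s).trans (le_of_eq ?_)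
      rw [sub_zero, mul_pow]
      ring
    rw [integral_const_mul, integral_pow_abs_sub_uIoc, sub_zero, abs_of_nonneg (by positivity)] at h1
    refine (mul_le_mul_of_nonneg_left h1 hα).trans (le_of_eq ?_)
    rw [Nat.factorial_succ]
    push_cast
    field_simp
    ring

lemma summable_picard_bound (α M c : ℝ) :
    Summable fun n : ℕ => (α * M) ^ n / n.factorial * c :=
  (Real.summable_pow_div_factorial _).mul_right c

lemma summable_picard (hα : 0 ≤ α) (t : ℝ) : Summable fun n => picard α f n t :=
  Summable.of_norm_bounded (summable_picard_bound α |t| ‖f‖) fun n => norm_picard_le hα n t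

/-- The solution of `σ' = α refl (tr (2 t) σ)`, `σ(0) = f`. -/
def sol (α : ℝ) (f : E) (t : ℝ) : E := ∑' n, picard α f n t

lemma sol_zero (α : ℝ) (f : E) : sol α f 0 = f := by
  rw [sol, tsum_eq_single 0]
  · rfl
  · intro n hn
    obtain ⟨m, rfl⟩ := Nat.exists_eq_succ_of_ne_zero hn
    simp [picard]

lemma hasDerivAt_sol (hα : 0 ≤ α) (t : ℝ) :
    HasDerivAt (sol α f) (α • refl (tr (2 * t) (sol α f t))) t := by
  let g' : ℕ → ℝ → E := fun n s => α • refl (tr (2 * s) (picard α f n s))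
  -- The ball of radius `M` about `0` contains both `t` and `0`, and the differentiated terms have a
  -- summable uniform bound on it.
  let M := |t| + 1
  have hb : ∀ n, ∀ y ∈ Metric.ball (0 : ℝ) M,
      ‖g' n y‖ ≤ α * ((α * M) ^ n / n.factorial * ‖f‖) := fun n y hy => by
    have hy' : |y| ≤ M := (mem_ball_zero_iff.1 hy).le
    simp only [g', norm_smul, norm_refl, norm_tr, Real.norm_of_nonneg hα]
    refine mul_le_mul_of_nonneg_left ((norm_picard_le hα n y).trans ?_) hα
    gcongr
  have htM : t ∈ Metric.ball (0 : ℝ) M := by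
    rw [mem_ball_zero_iff, Real.norm_eq_abs]
    exact lt_add_one _
  have hd : ∀ n, ∀ y ∈ Metric.ball (0 : ℝ) M, HasDerivAt (picard α f (n + 1)) (g' n y) y :=
    fun n y _ => hasDerivAt_picard_succ n y
  have h : HasDerivAt (fun z => ∑' n, picard α f (n + 1) z) (∑' n, g' n t) t :=
    hasDerivAt_tsum_of_isPreconnected ((summable_picard_bound α M ‖f‖).mul_left α)
      Metric.isOpen_ball (convex_ball _ _).isPreconnected hd hb htM
      ((summable_nat_add_iff 1).2 (summable_picard hα t)) htM
  have h0 : sol α f = fun z => f + ∑' n, picard α f (n + 1) z := by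
    funext z
    rw [sol, (summable_picard hα z).tsum_eq_zero_add]
    rfl
  rw [h0]
  refine (h.const_add f).congr_deriv ?_
  rw [← h0]
  simp only [g', sol]
  rw [tsum_const_smul'' α, ContinuousLinearMap.map_tsum _ (summable_picard hα t),
    ContinuousLinearMap.map_tsum]
  exact (tr (2 * t)).summable (summable_picard hα t)

/-- Translations and reflection are isometries, so the right-hand side is Lipschitz with constant
`α` at every time. -/
lemma sol_unique (hα : 0 ≤ α) {σ τ : ℝ → E} (h0 : σ 0 = τ 0)
    (hσ : ∀ t, 0 ≤ t → HasDerivAt σ (α • refl (tr (2 * t) (σ t))) t)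
    (hτ : ∀ t, 0 ≤ t → HasDerivAt τ (α • refl (tr (2 * t) (τ t))) t) {t : ℝ} (ht : 0 ≤ t) :
    σ t = τ t := by
  refine ODE_solution_unique (a := 0) (b := t) (K := α.toNNReal)
    (v := fun s x => α • refl (tr (2 * s) x)) (fun s => ?_)
    (fun s hs => (hσ s hs.1).continuousAt.continuousWithinAt)
    (fun s hs => (hσ s hs.1).hasDerivWithinAt)
    (fun s hs => (hτ s hs.1).continuousAt.continuousWithinAt)
    (fun s hs => (hτ s hs.1).hasDerivWithinAt) h0 ⟨ht, le_rfl⟩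
  refine LipschitzWith.of_dist_le_mul fun x y => le_of_eq ?_
  rw [dist_eq_norm, dist_eq_norm, ← smul_sub, ← map_sub, ← map_sub, norm_smul, norm_refl, norm_tr,
    Real.norm_of_nonneg hα, Real.coe_toNNReal _ hα]

/-! ### Gauge bounds for the series; the gain at time `1`. -/

section Gauge

variable {G : ℝ → E → Prop}

lemma IsGauge.picard (hG : IsGauge G) (hα : 0 ≤ α) {c : ℝ} (hf : G c f) (n : ℕ) {t : ℝ}
    (ht : 0 ≤ t) : G ((α * t) ^ n / n.factorial * c) (picard α f n t) := by
  induction n generalizing t with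
  | zero => simpa [DampedWave.picard] using hf
  | succ n ih =>
    have h := hG.smul hα (hG.integral ht (c := fun s => (α * s) ^ n / n.factorial * c)
      (by fun_prop) (continuous_refl_tr (continuous_picard n))
      (fun s hs => hG.refl (hG.tr (2 * s) (ih hs))))
    rw [DampedWave.picard]
    convert h using 1
    simp only [mul_pow]
    rw [intervalIntegral.integral_mul_const, intervalIntegral.integral_div,
      intervalIntegral.integral_const_mul, integral_pow, Nat.factorial_succ]
    push_cast
    field_simp
    ring

lemma hasSum_exp_mul (a c : ℝ) : HasSum (fun n : ℕ => a ^ n / n.factorial * c) (Real.exp a * c) := by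
  rw [Real.exp_eq_exp_ℝ]
  exact (NormedSpace.expSeries_div_hasSum_exp a).mul_right c

lemma IsGauge.sol (hG : IsGauge G) (hα : 0 ≤ α) {c : ℝ} (hf : G c f) {t : ℝ} (ht : 0 ≤ t) :
    G (Real.exp (α * t) * c) (sol α f t) :=
  hG.hasSum (hasSum_exp_mul _ c) (summable_picard hα t).hasSum fun n => hG.picard hα hf n ht

/-- The source of the decay: the shift `2 s` runs through exactly one period as `s` runs through
`[0,1]`, so the integral averages `f` over the whole circle. -/
lemma picard_one_of_mean_eq_zero (hf : mean f = 0) : picard α f 1 1 = 0 := by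
  have h : ∫ s in (0 : ℝ)..1, tr (2 * s) f = 0 := by
    rw [intervalIntegral.integral_comp_mul_left (fun s => tr s f) two_ne_zero]
    simp [integral_tr_period hf]
  simp only [picard]
  have hc : Continuous fun s : ℝ => tr (2 * s) f :=
    Continuous.tr (continuous_const.mul continuous_id) continuous_const
  rw [ContinuousLinearMap.intervalIntegral_comp_comm _ (hc.intervalIntegrable _ _), h]
  simp

lemma IsGauge.sol_one (hG : IsGauge G) (hα : 0 ≤ α) {c : ℝ} (hf : G c f) (hm : mean f = 0) :
    G ((Real.exp α - α) * c) (DampedWave.sol α f 1) := by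
  -- The first-order term vanishes, so its share `α c` can be dropped from the majorant `e^α c`.
  have hsum := (hasSum_exp_mul α c).update 1 0
  have e : (0 : ℝ) - α ^ 1 / (Nat.factorial 1) * c + Real.exp α * c = (Real.exp α - α) * c := by
    simp
    ring
  rw [e] at hsum
  refine hG.hasSum hsum (summable_picard hα 1).hasSum fun n => ?_
  rcases eq_or_ne n 1 with rfl | hn
  · rw [Function.update_self, picard_one_of_mean_eq_zero hm]
    simpa using hG.smul le_rfl hf
  · rw [Function.update_of_ne hn]
    simpa using hG.picard hα hf n zero_le_one

end Gauge

/-! ### The evolution on the circle: semigroup property and exponential decay. -/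

/-- The solution at time `t` of `ρ_t = ρ_x + α (refl ρ - ρ)`, `ρ(0) = f`. -/
def evo (α : ℝ) (f : E) (t : ℝ) : E := Real.exp (-(α * t)) • tr t (sol α f t)

lemma evo_zero (α : ℝ) (f : E) : evo α f 0 = f := by
  simp [evo, sol_zero]

lemma continuous_sol (hα : 0 ≤ α) : Continuous (sol α f) :=
  continuous_iff_continuousAt.2 fun t => (hasDerivAt_sol hα t).continuousAt

lemma continuous_evo (hα : 0 ≤ α) : Continuous (evo α f) :=
  Continuous.smul (f := fun t => Real.exp (-(α * t))) (by fun_prop)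
    (Continuous.tr continuous_id (continuous_sol hα))

lemma evo_add_left (hα : 0 ≤ α) (f g : E) {t : ℝ} (ht : 0 ≤ t) :
    evo α (f + g) t = evo α f t + evo α g t := by
  have h : sol α (f + g) t = sol α f t + sol α g t := by
    refine sol_unique (τ := fun t => sol α f t + sol α g t) hα (by simp [sol_zero])
      (fun s _ => hasDerivAt_sol hα s) (fun s _ => ?_) ht
    refine ((hasDerivAt_sol hα s).add (hasDerivAt_sol hα s)).congr_deriv ?_
    simp only [map_add, smul_add]
  simp only [evo, h, map_add, smul_add]

lemma evo_smul_left (hα : 0 ≤ α) (c : ℝ) (f : E) {t : ℝ} (ht : 0 ≤ t) :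
    evo α (c • f) t = c • evo α f t := by
  have h : sol α (c • f) t = c • sol α f t := by
    refine sol_unique (τ := fun t => c • sol α f t) hα (by simp [sol_zero])
      (fun s _ => hasDerivAt_sol hα s) (fun s _ => ?_) ht
    refine ((hasDerivAt_sol hα s).const_smul c).congr_deriv ?_
    rw [map_smul, map_smul, smul_comm]
  simp only [evo, h, map_smul]
  rw [smul_comm]

/-- The equation for `σ` is not autonomous, but `tr t` turns the shift `2 (s + t)` into `2 s`: since
`refl` reverses translations, `tr t (refl (tr (2 (s + t)) g)) = refl (tr (2 s) (tr t g))`.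
Uniqueness then concludes. -/
lemma evo_add (hα : 0 ≤ α) (f : E) {s t : ℝ} (hs : 0 ≤ s) :
    evo α f (s + t) = evo α (evo α f t) s := by
  have h : Real.exp (-(α * t)) • tr t (sol α f (s + t)) = sol α (evo α f t) s := by
    refine sol_unique (σ := fun s => Real.exp (-(α * t)) • tr t (sol α f (s + t))) hα
      (by simp [sol_zero, evo]) (fun r _ => ?_) (fun r _ => hasDerivAt_sol hα r) hs
    have h1 := (hasDerivAt_sol (f := f) hα (r + t)).comp_add_const r t
    have h2 := ((tr t).hasFDerivAt.comp_hasDerivAt r h1).const_smul (Real.exp (-(α * t)))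
    refine h2.congr_deriv ?_
    simp only [map_smul]
    rw [smul_comm, refl_tr, refl_tr, refl_tr, tr_tr, tr_tr]
    congr 4
    ring
  rw [evo, evo, ← h, map_smul, tr_tr, smul_smul, ← Real.exp_add]
  congr 2
  ring

section Gauge

variable {G : ℝ → E → Prop}

lemma IsGauge.evo (hG : IsGauge G) (hα : 0 ≤ α) {c : ℝ} (hf : G c f) {t : ℝ} (ht : 0 ≤ t) :
    G c (evo α f t) := by
  have h := hG.smul (Real.exp_pos (-(α * t))).le (hG.tr t (hG.sol hα hf ht))
  rwa [← mul_assoc, ← Real.exp_add, neg_add_cancel, Real.exp_zero, one_mul] at h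

lemma IsGauge.evo_one (hG : IsGauge G) (hα : 0 ≤ α) {c : ℝ} (hf : G c f) (hm : mean f = 0) :
    G ((1 - α * Real.exp (-α)) * c) (DampedWave.evo α f 1) := by
  have h := hG.smul (Real.exp_pos (-(α * 1))).le (hG.tr 1 (hG.sol_one hα hf hm))
  rw [← mul_assoc, mul_one, mul_sub, ← Real.exp_add, neg_add_cancel, Real.exp_zero,
    mul_comm (Real.exp (-α))] at h
  rwa [DampedWave.evo, mul_one]

lemma mean_evo (hα : 0 ≤ α) (hm : mean f = 0) {t : ℝ} (ht : 0 ≤ t) : mean (evo α f t) = 0 :=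
  isGauge_mean.evo hα (c := 0) hm ht

lemma IsGauge.evo_nat (hG : IsGauge G) (hα : 0 ≤ α) {c : ℝ} (hf : G c f) (hm : mean f = 0)
    (n : ℕ) : G ((1 - α * Real.exp (-α)) ^ n * c) (DampedWave.evo α f n) := by
  induction n with
  | zero => simpa [evo_zero] using hf
  | succ n ih =>
    have h := hG.evo_one hα ih (mean_evo hα hm n.cast_nonneg)
    rw [← evo_add hα f zero_le_one] at h
    rw [pow_succ', mul_assoc, Nat.cast_add, Nat.cast_one, add_comm (n : ℝ)]
    exact h

/-- Exponential decay of the solutions with mean zero. -/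
lemma exists_decay (hα : 0 < α) : ∃ C γ : ℝ, 0 < C ∧ 0 < γ ∧
    ∀ (G : ℝ → E → Prop), IsGauge G → ∀ (c : ℝ) (f : E) (t : ℝ), G c f → 0 ≤ c → mean f = 0 → 0 ≤ t →
      ∃ c' ≤ C * Real.exp (-γ * t) * c, G c' (DampedWave.evo α f t) := by
  -- The contraction factor over one unit of time; `0 < q` because `α < e^α`.
  set q := 1 - α * Real.exp (-α) with hq
  have hq1 : q < 1 := by
    have := mul_pos hα (Real.exp_pos (-α))
    linarith
  have hq0 : 0 < q := by
    have h1 : α < Real.exp α := by linarith [Real.add_one_le_exp α]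
    have h2 : α * Real.exp (-α) < Real.exp α * Real.exp (-α) :=
      mul_lt_mul_of_pos_right h1 (Real.exp_pos _)
    rw [← Real.exp_add, add_neg_cancel, Real.exp_zero] at h2
    linarith
  refine ⟨q⁻¹, -Real.log q, inv_pos.2 hq0, neg_pos.2 (Real.log_neg hq0 hq1), ?_⟩
  intro G hG c f t hf hc hm ht
  have hfl := Nat.floor_le ht
  -- Whole units of time gain a factor `q` each, and the remaining fraction loses nothing. Since
  -- `⌊t⌋ > t - 1`, the rounding costs at most `q⁻¹`, the value of `C`.
  refine ⟨q ^ ⌊t⌋₊ * c, ?_, ?_⟩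
  · refine mul_le_mul_of_nonneg_right ?_ hc
    rw [neg_neg, ← Real.rpow_def_of_pos hq0, ← Real.rpow_natCast, ← Real.rpow_neg_one q,
      ← Real.rpow_add hq0]
    exact Real.rpow_le_rpow_of_exponent_ge hq0 hq1.le (by linarith [Nat.lt_floor_add_one t])
  · have h := hG.evo hα.le (hG.evo_nat hα.le hf hm ⌊t⌋₊) (sub_nonneg.2 hfl)
    rwa [← evo_add hα.le f (sub_nonneg.2 hfl), sub_add_cancel] at h

end Gauge


/-! ### Even and odd parts, and the displacement recovered from a function on the circle. -/

lemma intervalIntegrable_coe (f : E) (a b : ℝ) :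
    IntervalIntegrable (fun y : ℝ => f (y : Circ)) volume a b := by
  have hper : Function.Periodic (fun y : ℝ => f (y : Circ)) 2 := fun y => by
    simp only [AddCircle.coe_add_period]
  refine hper.intervalIntegrable₀ two_ne_zero ?_ a b
  rw [intervalIntegrable_iff_integrableOn_Ioc_of_le zero_le_two]
  have h := ((AddCircle.measurePreserving_mk (2 : ℝ) 0).integrable_comp
    (Lp.stronglyMeasurable f).aestronglyMeasurable).2 (L1.integrable_coeFn f)
  rwa [zero_add] at h

/-- The even part of a function on the circle. -/
def ev : E →L[ℝ] E := (1 / 2 : ℝ) • (ContinuousLinearMap.id ℝ E + refl)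

/-- The odd part of a function on the circle. -/
def od : E →L[ℝ] E := (1 / 2 : ℝ) • (ContinuousLinearMap.id ℝ E - refl)

lemma ev_apply (f : E) : ev f = (1 / 2 : ℝ) • (f + refl f) := rfl

lemma od_apply (f : E) : od f = (1 / 2 : ℝ) • (f - refl f) := rfl

lemma ev_add_od (f : E) : ev f + od f = f := by
  rw [ev_apply, od_apply]
  module

lemma refl_od (f : E) : refl (od f) = -od f := by
  rw [od_apply, map_smul, map_sub, refl_refl]
  module

lemma refl_ev (f : E) : refl (ev f) = ev f := by
  rw [ev_apply, map_smul, map_add, refl_refl, add_comm]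

lemma ev_eq_zero {f : E} (hf : refl f = -f) : ev f = 0 := by
  rw [ev_apply, hf, add_neg_cancel, smul_zero]

lemma ext_ev_od {f g : E} (h1 : restr (ev f) = restr (ev g)) (h2 : restr (od f) = restr (od g)) :
    f = g := by
  rw [← ev_add_od f, ← ev_add_od g]
  refine ext_restr ?_ ?_
  · rw [map_add, map_add, h1, h2]
  · rw [map_add, map_add, map_add, map_add, refl_od, refl_od, refl_ev, refl_ev, map_neg, map_neg,
      h1, h2]

/-- The functional `f ↦ ½ ∫_{-x}^x f = ∫₀ˣ ev f`. -/
def ell (x : ℝ) : E →L[ℝ] ℝ where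
  toFun f := ∫ y in Set.Ioc 0 x, restr (ev f) y ∂μ
  map_add' f g := by
    rw [map_add, map_add, ← integral_add (L1.integrable_coeFn _).integrableOn
      (L1.integrable_coeFn _).integrableOn]
    exact integral_congr_ae (ae_restrict_of_ae (Lp.coeFn_add _ _))
  map_smul' c f := by
    rw [RingHom.id_apply, ← integral_smul, map_smul, map_smul]
    exact integral_congr_ae (ae_restrict_of_ae (Lp.coeFn_smul _ _))
  cont := (continuous_setIntegral _).comp (restr.continuous.comp ev.continuous)

lemma ell_apply (x : ℝ) (f : E) : ell x f = ∫ y in Set.Ioc 0 x, restr (ev f) y ∂μ := rfl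

lemma ell_eq_zero (x : ℝ) {f : E} (hf : refl f = -f) : ell x f = 0 := by
  rw [ell_apply, ev_eq_zero hf, map_zero,
    integral_congr_ae (ae_restrict_of_ae (Lp.coeFn_zero ℝ 1 μ))]
  simp

lemma ell_ev (x : ℝ) (f : E) : ell x (ev f) = ell x f := by
  conv_rhs => rw [← ev_add_od f]
  rw [map_add, ell_eq_zero x (refl_od f), add_zero]

lemma restrict_Ioc_mu {x : ℝ} (hx : x ≤ 1) :
    μ.restrict (Set.Ioc 0 x) = volume.restrict (Set.Ioc 0 x) := by
  change (volume.restrict (Set.Ioo (0 : ℝ) 1)).restrict (Set.Ioc 0 x) = _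
  rw [Measure.restrict_congr_set (Ioo_ae_eq_Ioc (μ := volume) (a := (0 : ℝ)) (b := 1)),
    Measure.restrict_restrict measurableSet_Ioc,
    Set.inter_eq_left.2 (Set.Ioc_subset_Ioc_right hx)]

lemma ell_eq_integral {x : ℝ} (hx : x ∈ Set.Icc (0 : ℝ) 1) {f : E} {g : ℝ → ℝ}
    (hg : restr (ev f) =ᵐ[μ] g) : ell x f = ∫ y in (0 : ℝ)..x, g y := by
  rw [ell_apply, integral_congr_ae (ae_restrict_of_ae hg), restrict_Ioc_mu hx.2,
    intervalIntegral.integral_of_le hx.1]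

lemma coeFn_restr_ev (f : E) :
    restr (ev f) =ᵐ[μ] fun y => 1 / 2 * (f (y : Circ) + f ((-y : ℝ) : Circ)) := by
  rw [ev_apply, map_smul, map_add]
  filter_upwards [Lp.coeFn_smul (1 / 2 : ℝ) (restr f + restr (refl f)),
    Lp.coeFn_add (restr f) (restr (refl f)), coeFn_restr f, coeFn_restr_refl f] with y h1 h2 h3 h4
  rw [h1, Pi.smul_apply, h2, Pi.add_apply, h3, h4, smul_eq_mul]

lemma coeFn_restr_od (f : E) :
    restr (od f) =ᵐ[μ] fun y => 1 / 2 * (f (y : Circ) - f ((-y : ℝ) : Circ)) := by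
  rw [od_apply, map_smul, map_sub]
  filter_upwards [Lp.coeFn_smul (1 / 2 : ℝ) (restr f - restr (refl f)),
    Lp.coeFn_sub (restr f) (restr (refl f)), coeFn_restr f, coeFn_restr_refl f] with y h1 h2 h3 h4
  rw [h1, Pi.smul_apply, h2, Pi.sub_apply, h3, h4, smul_eq_mul]

lemma ell_eq {x : ℝ} (hx : x ∈ Set.Icc (0 : ℝ) 1) (f : E) :
    ell x f = 1 / 2 * ∫ y in (-x)..x, f (y : Circ) := by
  rw [ell_eq_integral hx (coeFn_restr_ev f), intervalIntegral.integral_const_mul,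
    intervalIntegral.integral_add (intervalIntegrable_coe f _ _),
    intervalIntegral.integral_comp_neg (fun y => f (y : Circ)), neg_zero, add_comm,
    intervalIntegral.integral_add_adjacent_intervals (intervalIntegrable_coe f _ _)
      (intervalIntegrable_coe f _ _)]
  have := (IntervalIntegrable.iff_comp_neg (by simp)).1 (intervalIntegrable_coe f (-0) (-x))
  simpa using this

lemma integral_tr (t a b : ℝ) (f : E) :
    ∫ y in a..b, tr t f (y : Circ) = ∫ y in (a + t)..(b + t), f (y : Circ) := by
  rw [← intervalIntegral.integral_comp_add_right (fun y => f (y : Circ))]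
  refine intervalIntegral.integral_congr_ae ?_
  filter_upwards [quasiMeasurePreserving_coe.ae (coeFn_tr t f)] with y hy _
  rw [hy, AddCircle.coe_add]

lemma ell_tr {x : ℝ} (hx : x ∈ Set.Icc (0 : ℝ) 1) (t : ℝ) (f : E) :
    ell x (tr t f) = 1 / 2 * ∫ y in (t - x)..(t + x), f (y : Circ) := by
  rw [ell_eq hx, integral_tr]
  rw [neg_add_eq_sub, add_comm x t]

lemma abs_ell_le (x : ℝ) (f : E) : ‖ell x f‖ ≤ ‖f‖ := by
  rw [ell_apply]
  refine (norm_integral_le_integral_norm _).trans ?_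
  refine (setIntegral_le_integral (L1.integrable_coeFn _).norm
    (.of_forall fun _ => norm_nonneg _)).trans ?_
  rw [← L1.norm_eq_integral_norm]
  have h1 : ‖restr (ev f)‖ ≤ ‖ev f‖ := by
    rw [norm_split (ev f)]
    exact le_add_of_nonneg_right (norm_nonneg _)
  refine h1.trans ?_
  rw [ev_apply, norm_smul]
  have := norm_add_le f (refl f)
  rw [norm_refl] at this
  norm_num
  linarith

lemma memLp_ell (f : E) : MemLp (fun x => ell x f) 1 μ := by
  refine MemLp.of_bound (AEStronglyMeasurable.congr (f := fun x : ℝ =>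
    1 / 2 * ∫ y in (-x)..x, f (y : Circ)) ?_ ?_) ‖f‖ (.of_forall fun x => abs_ell_le x f)
  · refine Continuous.aestronglyMeasurable (continuous_const.mul ?_)
    have h : (fun x : ℝ => ∫ y in (-x)..x, f (y : Circ)) = fun x : ℝ =>
        (∫ y in (0 : ℝ)..x, f (y : Circ)) - ∫ y in (0 : ℝ)..(-x), f (y : Circ) := by
      funext x
      rw [intervalIntegral.integral_interval_sub_left (intervalIntegrable_coe f _ _)
        (intervalIntegrable_coe f _ _)]
    have hc := intervalIntegral.continuous_primitive (intervalIntegrable_coe f) 0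
    rw [h]
    exact hc.sub (hc.comp continuous_neg)
  · refine (ae_restrict_iff' measurableSet_Ioo).2 (.of_forall fun x hx => ?_)
    exact (ell_eq ⟨hx.1.le, hx.2.le⟩ f).symm

/-- The displacement `x ↦ ∫₀ˣ ev f` of a state, as an element of `L¹(0,1)`. -/
def displ : E →L[ℝ] F :=
  LinearMap.mkContinuous
    { toFun := fun f => (memLp_ell f).toLp _
      map_add' := fun f g => by
        refine Lp.ext ?_
        filter_upwards [(memLp_ell (f + g)).coeFn_toLp, (memLp_ell f).coeFn_toLp,
          (memLp_ell g).coeFn_toLp, Lp.coeFn_add ((memLp_ell f).toLp _)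
            ((memLp_ell g).toLp _)] with y h1 h2 h3 h4
        rw [h1, h4, Pi.add_apply, h2, h3, map_add]
      map_smul' := fun c f => by
        refine Lp.ext ?_
        filter_upwards [(memLp_ell (c • f)).coeFn_toLp, (memLp_ell f).coeFn_toLp,
          Lp.coeFn_smul c ((memLp_ell f).toLp _)] with y h1 h2 h4
        rw [h1, RingHom.id_apply, h4, Pi.smul_apply, h2, map_smul] } 1
    (fun f => by
      simp only [LinearMap.coe_mk, AddHom.coe_mk, one_mul]
      have h := Lp.norm_le_of_ae_bound (f := (memLp_ell f).toLp _) (norm_nonneg f)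
        (by
          filter_upwards [(memLp_ell f).coeFn_toLp] with x hx
          rw [hx]
          exact abs_ell_le x f)
      simpa [measureUnivNNReal] using h)

lemma coeFn_displ (f : E) : displ f =ᵐ[μ] fun x => ell x f := (memLp_ell f).coeFn_toLp

lemma displ_eq_zero {f : E} (hf : refl f = -f) : displ f = 0 := by
  refine Lp.ext ?_
  filter_upwards [coeFn_displ f, Lp.coeFn_zero ℝ 1 μ] with x h1 h2
  rw [h1, h2, ell_eq_zero x hf, Pi.zero_apply]

/-- Shifting the window `[-x, x]` by `h` changes the integral by what enters at `x` minus what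
leaves at `-x`, which is twice the odd part of the integrated translates at `x`. This exact identity
gives `z_t` as the odd part. -/
lemma displ_tr_sub (f : E) (h : ℝ) :
    displ (tr h f) - displ f = restr (od (∫ r in (0 : ℝ)..h, tr r f)) := by
  have hI := coeFn_intervalIntegral_tr f h
  have hneg : Measure.QuasiMeasurePreserving (fun y : ℝ => ((-y : ℝ) : Circ)) μ volume :=
    (quasiMeasurePreserving_coe.comp
      (Measure.measurePreserving_neg (volume : Measure ℝ)).quasiMeasurePreserving).mono_left
      Measure.restrict_le_self.absolutelyContinuous
  refine Lp.ext ?_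
  filter_upwards [Lp.coeFn_sub (displ (tr h f)) (displ f), coeFn_displ (tr h f), coeFn_displ f,
    coeFn_restr_od (∫ r in (0 : ℝ)..h, tr r f), quasiMeasurePreserving_coe_Ioo.ae hI, hneg.ae hI,
    ae_restrict_mem measurableSet_Ioo] with x h1 h2 h3 h4 h5 h6 hx
  have hx' : x ∈ Set.Icc (0 : ℝ) 1 := ⟨hx.1.le, hx.2.le⟩
  have e : ∀ a : ℝ, ∫ r in (0 : ℝ)..h, f ((a : Circ) + (r : Circ)) =
      ∫ r in a..(a + h), f (r : Circ) := fun a => by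
    have := intervalIntegral.integral_comp_add_left (a := 0) (b := h)
      (fun y => f (y : Circ)) a
    rw [add_zero] at this
    rw [← this]
    simp only [AddCircle.coe_add]
  rw [h1, Pi.sub_apply, h2, h3, h4, h5, h6, ell_tr hx', ell_eq hx', e, e]
  have i := intervalIntegrable_coe f
  rw [← intervalIntegral.integral_interval_sub_left (i 0 (h + x)) (i 0 (h - x)),
    ← intervalIntegral.integral_interval_sub_left (i 0 x) (i 0 (-x)),
    ← intervalIntegral.integral_interval_sub_left (i 0 (x + h)) (i 0 x),
    ← intervalIntegral.integral_interval_sub_left (i 0 (-x + h)) (i 0 (-x)),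
    add_comm h x, sub_eq_neg_add h x]
  ring

lemma hasDerivAt_displ_tr (f : E) (t : ℝ) :
    HasDerivAt (fun s => displ (tr s f)) (restr (od (tr t f))) t := by
  have hc : Continuous fun r => tr r (tr t f) := Continuous.tr continuous_id continuous_const
  have h1 : HasDerivAt (fun h => ∫ r in (0 : ℝ)..h, tr r (tr t f)) (tr 0 (tr t f)) 0 :=
    (hc.integral_hasStrictDerivAt 0 0).hasDerivAt
  rw [tr_zero] at h1
  have h2 : HasDerivAt (fun h => restr (od (∫ r in (0 : ℝ)..h, tr r (tr t f))))
      (restr (od (tr t f))) 0 :=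
    (restr.comp od).hasFDerivAt.comp_hasDerivAt (0 : ℝ) h1
  have h3 : HasDerivAt (fun h => displ (tr h (tr t f))) (restr (od (tr t f))) 0 := by
    refine (h2.add_const (displ (tr t f))).congr_of_eventuallyEq (.of_forall fun h => ?_)
    simp only [← displ_tr_sub, sub_add_cancel]
  have h4 := HasDerivAt.comp_sub_const (x := t) (a := t) (f := fun h => displ (tr h (tr t f)))
    (by rwa [sub_self])
  refine h4.congr_of_eventuallyEq (.of_forall fun s => ?_)
  simp only [tr_tr, sub_add_cancel]

/-- A product rule for operators that are only strongly continuous: `s ↦ tr s` is not differentiable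
in operator norm, so joint continuity and differentiability along the single vector `τ t` are used
instead. -/
lemma hasDerivAt_clm_apply_of_continuous {V W : Type*} [NormedAddCommGroup V] [NormedSpace ℝ V]
    [NormedAddCommGroup W] [NormedSpace ℝ W] {K : ℝ → V →L[ℝ] W}
    (hK : Continuous fun q : ℝ × V => K q.1 q.2) {τ : ℝ → V} {τ' : V} {k : W} {t : ℝ}
    (hk : HasDerivAt (fun s => K s (τ t)) k t) (hτ : HasDerivAt τ τ' t) :
    HasDerivAt (fun s => K s (τ s)) (k + K t τ') t := by
  rw [hasDerivAt_iff_tendsto_slope] at hτ hk ⊢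
  have hp : Tendsto (fun s => (s, slope τ t s)) (𝓝[≠] t) (𝓝 (t, τ')) :=
    (tendsto_id.mono_left nhdsWithin_le_nhds).prodMk_nhds hτ
  have h2 : Tendsto (fun s => K s (slope τ t s)) (𝓝[≠] t) (𝓝 (K t τ')) :=
    (hK.tendsto (t, τ')).comp hp
  refine (hk.add h2).congr fun s => ?_
  simp only [slope_def_module, map_smul, map_sub]
  rw [← smul_add]
  congr 1
  abel

lemma hasDerivAt_displ_tr_comp {τ : ℝ → E} {τ' : E} {t : ℝ} (hτ : HasDerivAt τ τ' t) :
    HasDerivAt (fun s => displ (tr s (τ s))) (restr (od (tr t (τ t))) + displ (tr t τ')) t := by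
  have hK : Continuous fun q : ℝ × E => (displ.comp (tr q.1)) q.2 :=
    displ.continuous.comp continuous_tr
  have h := hasDerivAt_clm_apply_of_continuous (K := fun s => displ.comp (tr s)) hK
    (hasDerivAt_displ_tr (τ t) t) hτ
  simpa only [ContinuousLinearMap.comp_apply] using h

/-- Lebesgue differentiation of `x ↦ ∫₀ˣ ev (f - g)`, which is identically zero on `[0,1]`. -/
lemma restr_ev_eq_of_ell {f g : E} (h : ∀ x ∈ Set.Icc (0 : ℝ) 1, ell x f = ell x g) :
    restr (ev f) = restr (ev g) := by
  rw [← sub_eq_zero, ← map_sub, ← map_sub]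
  set w : F := restr (ev (f - g)) with hw
  have hwi : IntervalIntegrable (w : ℝ → ℝ) volume 0 1 := by
    rw [intervalIntegrable_iff_integrableOn_Ioo_of_le zero_le_one]
    exact L1.integrable_coeFn w
  have h0 : ∀ x ∈ Set.Icc (0 : ℝ) 1, ∫ y in (0 : ℝ)..x, w y = 0 := fun x hx => by
    rw [← ell_eq_integral hx (ae_eq_refl _), map_sub, h x hx, sub_self]
  refine Lp.ext ?_
  filter_upwards [Lp.coeFn_zero ℝ 1 μ, ae_restrict_of_ae hwi.ae_hasDerivAt_integral,
    ae_restrict_mem measurableSet_Ioo] with x h1 h2 hx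
  rw [Set.uIcc_of_le zero_le_one] at h2
  have h3 := h2 ⟨hx.1.le, hx.2.le⟩ 0 ⟨le_rfl, zero_le_one⟩
  have h4 : (fun x => ∫ y in (0 : ℝ)..x, w y) =ᶠ[𝓝 x] fun _ => 0 := by
    filter_upwards [Ioo_mem_nhds hx.1 hx.2] with y hy
    exact h0 y ⟨hy.1.le, hy.2.le⟩
  rw [h1, Pi.zero_apply]
  exact (h3.congr_of_eventuallyEq h4.symm).unique (hasDerivAt_const x (0 : ℝ))

/-! ### Duhamel's formula and its equivalence with the evolution. -/

/-- The state at time `t` obtained from the initial state `f` and the source `-2 α v`. -/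
def duhamel (α : ℝ) (f : E) (v : ℝ → E) (t : ℝ) : E :=
  tr t (f - (2 * α) • ∫ s in (0 : ℝ)..t, tr (-s) (v s))

variable {α : ℝ} {f : E} {v : ℝ → E}

lemma continuous_tr_neg (hv : Continuous v) : Continuous fun s => tr (-s) (v s) :=
  Continuous.tr continuous_neg hv

lemma hasDerivAt_duhamel_aux (hv : Continuous v) (t : ℝ) :
    HasDerivAt (fun t => f - (2 * α) • ∫ s in (0 : ℝ)..t, tr (-s) (v s))
      (-((2 * α) • tr (-t) (v t))) t :=
  HasDerivAt.const_sub f (HasDerivAt.const_smul (2 * α)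
    ((continuous_tr_neg hv).integral_hasStrictDerivAt 0 t).hasDerivAt)

/-- The source acts on the velocity only: an odd function has zero displacement, so its term drops
out of the product rule. -/
lemma hasDerivAt_displ_duhamel (hv : Continuous v) (hodd : ∀ s, refl (v s) = -v s) (t : ℝ) :
    HasDerivAt (fun t => displ (duhamel α f v t)) (restr (od (duhamel α f v t))) t := by
  have h := hasDerivAt_displ_tr_comp (hasDerivAt_duhamel_aux (α := α) (f := f) hv t)
  refine h.congr_deriv ?_
  rw [map_neg, map_smul, map_neg, map_smul, tr_tr, add_neg_cancel, tr_zero,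
    displ_eq_zero (hodd t), smul_zero, neg_zero, add_zero]
  rfl

lemma ell_duhamel (hv : Continuous v) (x t : ℝ) :
    ell x (duhamel α f v t) =
      ell x (tr t f) - 2 * α * ∫ s in (0 : ℝ)..t, ell x (tr (t - s) (v s)) := by
  have h := ContinuousLinearMap.intervalIntegral_comp_comm (μ := volume) ((ell x).comp (tr t))
    ((continuous_tr_neg hv).intervalIntegrable 0 t)
  simp only [ContinuousLinearMap.comp_apply, tr_tr, ← sub_eq_add_neg] at h
  rw [duhamel, map_sub, map_sub, map_smul, map_smul, h, smul_eq_mul]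

lemma tr_od_tr (t : ℝ) (f : E) :
    (2 : ℝ) • tr (-t) (od (tr t f)) = f - refl (tr (2 * t) f) := by
  rw [od_apply, map_smul, smul_smul, map_sub, tr_tr, refl_tr, refl_tr, tr_tr, neg_add_cancel,
    tr_zero]
  norm_num
  congr 3
  ring

lemma evo_eq_duhamel (hα : 0 ≤ α) (f : E) (t : ℝ) :
    evo α f t = duhamel α f (fun s => od (evo α f s)) t := by
  let τ : ℝ → E := fun t => Real.exp (-(α * t)) • sol α f t
  have hv : Continuous fun s => od (evo α f s) := od.continuous.comp (continuous_evo hα)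
  have hevo : ∀ t, evo α f t = tr t (τ t) := fun t => by rw [evo, ← map_smul]
  have hτ : ∀ t, HasDerivAt τ (-((2 * α) • tr (-t) (od (evo α f t)))) t := fun t => by
    have he : HasDerivAt (fun t => Real.exp (-(α * t))) (Real.exp (-(α * t)) * (-α)) t := by
      have := ((hasDerivAt_id t).const_mul α).neg.exp
      simpa using this
    refine (he.smul (hasDerivAt_sol hα t)).congr_deriv ?_
    rw [hevo, mul_comm 2 α, mul_smul α 2, tr_od_tr]
    simp only [τ, map_smul]
    module
  have h := intervalIntegral.integral_eq_sub_of_hasDerivAt (a := 0) (b := t) (fun s _ => hτ s)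
    ((((continuous_tr_neg hv).const_smul (2 * α)).neg).intervalIntegrable _ _)
  rw [intervalIntegral.integral_neg, intervalIntegral.integral_smul] at h
  have h0 : τ 0 = f := by simp [τ, sol_zero]
  rw [hevo, duhamel, sub_eq_add_neg, h, h0, add_sub_cancel]

/-- With `v` the odd part of `r`, the integrand `2 tr (-t) (od (tr t τ))` is `τ - refl (tr (2t) τ)`
by `tr_od_tr`. The factor `e^{αt}` absorbs the first term and leaves the equation for `σ`. -/
lemma eq_evo_of_duhamel (hα : 0 ≤ α) {r : ℝ → E} (hv : Continuous v)
    (hvr : ∀ t, 0 ≤ t → v t = od (r t)) (hr : ∀ t, 0 ≤ t → r t = duhamel α f v t) {t : ℝ}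
    (ht : 0 ≤ t) : r t = evo α f t := by
  let τ : ℝ → E := fun t => f - (2 * α) • ∫ s in (0 : ℝ)..t, tr (-s) (v s)
  have hτ : ∀ t, 0 ≤ t → HasDerivAt (fun t => Real.exp (α * t) • τ t)
      (α • refl (tr (2 * t) (Real.exp (α * t) • τ t))) t := fun t ht => by
    have he : HasDerivAt (fun t => Real.exp (α * t)) (Real.exp (α * t) * α) t := by
      have := ((hasDerivAt_id t).const_mul α).exp
      simpa using this
    refine (he.smul (hasDerivAt_duhamel_aux (α := α) (f := f) hv t)).congr_deriv ?_
    rw [hvr t ht, hr t ht, duhamel, mul_comm 2 α, mul_smul α 2, tr_od_tr]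
    simp only [τ, map_smul, mul_comm 2 α]
    module
  have h := sol_unique hα (τ := sol α f) (by simp [τ, sol_zero]) hτ
    (fun s _ => hasDerivAt_sol hα s) ht
  rw [evo, ← h, map_smul, smul_smul, ← Real.exp_add, neg_add_cancel, Real.exp_zero, one_smul,
    hr t ht, duhamel]


/-! ### States as mean-zero functions on the circle. -/

section Encoding

variable {p : ℝ≥0∞}

lemma X.pos_zero (U : X p) {x : ℝ} (hx : x ∉ Set.Ioo (0 : ℝ) 1) : X.pos U x = 0 := U.1.2.2.1 x hx

lemma X.ac_pos (U : X p) : AbsolutelyContinuousOnInterval (X.pos U) 0 1 := U.1.2.1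

lemma X.ae_differentiableAt_pos (U : X p) : ∀ᵐ x ∂μ, DifferentiableAt ℝ (X.pos U) x := by
  refine (ae_restrict_iff' measurableSet_Ioo).2 ?_
  filter_upwards [U.ac_pos.ae_differentiableAt] with x hx hx'
  rw [Set.uIcc_of_le zero_le_one] at hx
  exact hx (Set.Ioo_subset_Icc_self hx')

lemma X.deriv_pos_add (U V : X p) :
    deriv (X.pos (U + V)) =ᵐ[μ] fun x => deriv (X.pos U) x + deriv (X.pos V) x := by
  filter_upwards [U.ae_differentiableAt_pos, V.ae_differentiableAt_pos] with x h1 h2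
  exact deriv_add h1 h2

lemma X.deriv_pos_smul (c : ℝ) (U : X p) (x : ℝ) :
    deriv (X.pos (c • U)) x = c * deriv (X.pos U) x :=
  deriv_const_smul_field c (X.pos U)

lemma X.vel_add (U V : X p) : X.vel (U + V) =ᵐ[μ] fun x => X.vel U x + X.vel V x :=
  Lp.coeFn_add U.2 V.2

lemma X.vel_smul (c : ℝ) (U : X p) : X.vel (c • U) =ᵐ[μ] fun x => c * X.vel U x :=
  Lp.coeFn_smul c U.2

lemma X.rho_add (U V : X p) : X.rho (U + V) =ᵐ[μ] fun x => X.rho U x + X.rho V x := by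
  filter_upwards [X.deriv_pos_add U V, X.vel_add U V] with x h1 h2
  simp only [X.rho, h1, h2]
  ring

lemma X.xi_add (U V : X p) : X.xi (U + V) =ᵐ[μ] fun x => X.xi U x + X.xi V x := by
  filter_upwards [X.deriv_pos_add U V, X.vel_add U V] with x h1 h2
  simp only [X.xi, h1, h2]
  ring

lemma X.rho_smul (c : ℝ) (U : X p) : X.rho (c • U) =ᵐ[μ] fun x => c * X.rho U x := by
  filter_upwards [X.vel_smul c U] with x h2
  simp only [X.rho, X.deriv_pos_smul, h2]
  ring

lemma X.xi_smul (c : ℝ) (U : X p) : X.xi (c • U) =ᵐ[μ] fun x => c * X.xi U x := by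
  filter_upwards [X.vel_smul c U] with x h2
  simp only [X.xi, X.deriv_pos_smul, h2]
  ring

lemma X.memLp_rho (U : X p) : MemLp (X.rho U) p μ := U.1.2.2.2.add (Lp.memLp U.2)

lemma X.memLp_xi (U : X p) : MemLp (X.xi U) p μ := U.1.2.2.2.sub (Lp.memLp U.2)

variable [hp : Fact (1 ≤ p)]

lemma X.memLp_one_rho (U : X p) : MemLp (X.rho U) 1 μ := U.memLp_rho.mono_exponent hp.out

lemma X.memLp_one_xi (U : X p) : MemLp (X.xi U) 1 μ := U.memLp_xi.mono_exponent hp.out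

lemma exists_enc (U : X p) : ∃ f : E, restr f = (X.memLp_one_rho U).toLp _ ∧
    restr (refl f) = (X.memLp_one_xi U).toLp _ := exists_restr_eq _ _

/-- The function on the circle which is `u' + v` at `x` and `u' - v` at `-x`, for `x` in `(0,1)`. -/
def encFun (U : X p) : E := (exists_enc U).choose

lemma restr_encFun (U : X p) : restr (encFun U) =ᵐ[μ] X.rho U := by
  rw [encFun, (exists_enc U).choose_spec.1]
  exact MemLp.coeFn_toLp _

lemma restr_refl_encFun (U : X p) : restr (refl (encFun U)) =ᵐ[μ] X.xi U := by
  rw [encFun, (exists_enc U).choose_spec.2]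
  exact MemLp.coeFn_toLp _

/-- `encFun` as a linear map. -/
def enc : X p →ₗ[ℝ] E where
  toFun := encFun
  map_add' U V := by
    refine ext_restr (Lp.ext ?_) (Lp.ext ?_)
    · rw [map_add]
      filter_upwards [Lp.coeFn_add (restr (encFun U)) (restr (encFun V)), restr_encFun U,
        restr_encFun V, restr_encFun (U + V), X.rho_add U V] with x h1 h2 h3 h4 h5
      rw [h4, h1, h5, Pi.add_apply, h2, h3]
    · rw [map_add, map_add]
      filter_upwards [Lp.coeFn_add (restr (refl (encFun U))) (restr (refl (encFun V))),
        restr_refl_encFun U, restr_refl_encFun V, restr_refl_encFun (U + V), X.xi_add U V]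
        with x h1 h2 h3 h4 h5
      rw [h4, h1, h5, Pi.add_apply, h2, h3]
  map_smul' c U := by
    rw [RingHom.id_apply]
    refine ext_restr (Lp.ext ?_) (Lp.ext ?_)
    · rw [map_smul]
      filter_upwards [Lp.coeFn_smul c (restr (encFun U)), restr_encFun U,
        restr_encFun (c • U), X.rho_smul c U] with x h1 h2 h4 h5
      rw [h4, h1, h5, Pi.smul_apply, h2, smul_eq_mul]
    · rw [map_smul, map_smul]
      filter_upwards [Lp.coeFn_smul c (restr (refl (encFun U))), restr_refl_encFun U,
        restr_refl_encFun (c • U), X.xi_smul c U] with x h1 h2 h4 h5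
      rw [h4, h1, h5, Pi.smul_apply, h2, smul_eq_mul]

lemma restr_enc (U : X p) : restr (enc U) =ᵐ[μ] X.rho U := restr_encFun U

lemma restr_refl_enc (U : X p) : restr (refl (enc U)) =ᵐ[μ] X.xi U := restr_refl_encFun U

lemma restr_od_enc (U : X p) : restr (od (enc U)) =ᵐ[μ] X.vel U := by
  filter_upwards [restr_enc U, restr_refl_enc U, coeFn_restr_od (enc U), coeFn_restr (enc U),
    coeFn_restr_refl (enc U)] with x h1 h2 h3 h4 h5
  rw [h3, ← h4, ← h5, h1, h2, X.rho, X.xi]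
  ring

lemma restr_ev_enc (U : X p) : restr (ev (enc U)) =ᵐ[μ] deriv (X.pos U) := by
  filter_upwards [restr_enc U, restr_refl_enc U, coeFn_restr_ev (enc U), coeFn_restr (enc U),
    coeFn_restr_refl (enc U)] with x h1 h2 h3 h4 h5
  rw [h3, ← h4, ← h5, h1, h2, X.rho, X.xi]
  ring

lemma ell_enc {x : ℝ} (hx : x ∈ Set.Icc (0 : ℝ) 1) (U : X p) : ell x (enc U) = X.pos U x := by
  have hac : AbsolutelyContinuousOnInterval (X.pos U) 0 x := by
    refine U.ac_pos.mono ?_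
    rw [Set.uIcc_of_le hx.1, Set.uIcc_of_le zero_le_one]
    exact Set.Icc_subset_Icc_right hx.2
  rw [ell_eq_integral hx (restr_ev_enc U), hac.integral_deriv_eq_sub,
    U.pos_zero (x := 0) (by simp), sub_zero]

lemma displ_enc (U : X p) : displ (enc U) =ᵐ[μ] X.pos U := by
  filter_upwards [coeFn_displ (enc U), ae_restrict_mem measurableSet_Ioo] with x h1 hx
  rw [h1, ell_enc ⟨hx.1.le, hx.2.le⟩]

omit hp in
lemma integral_period (f : E) (a : ℝ) : ∫ y in a..(a + 2), f (y : Circ) = mean f := by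
  rw [AddCircle.intervalIntegral_preimage 2 a (fun z : Circ => f z), mean, setInt_apply,
    setIntegral_univ]

omit hp in
lemma mean_eq_ell (f : E) : mean f = 2 * ell 1 f := by
  rw [ell_eq ⟨zero_le_one, le_rfl⟩, ← integral_period f (-1), show (-1 : ℝ) + 2 = 1 by norm_num]
  ring

lemma mean_enc (U : X p) : mean (enc U) = 0 := by
  rw [mean_eq_ell, ell_enc ⟨zero_le_one, le_rfl⟩, U.pos_zero (by simp), mul_zero]

lemma enc_injective : Function.Injective (enc : X p → E) := by
  intro U V h
  refine Prod.ext (Subtype.ext (funext fun x => ?_)) (Lp.ext ?_)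
  · change X.pos U x = X.pos V x
    by_cases hx : x ∈ Set.Ioo (0 : ℝ) 1
    · rw [← ell_enc ⟨hx.1.le, hx.2.le⟩, h, ell_enc ⟨hx.1.le, hx.2.le⟩]
    · rw [U.pos_zero hx, V.pos_zero hx]
  · have h1 := restr_od_enc U
    rw [h] at h1
    exact h1.symm.trans (restr_od_enc V)

lemma exists_enc_eq {f : E} (hm : mean f = 0) (h1 : MemLp (restr f) p μ)
    (h2 : MemLp (restr (refl f)) p μ) : ∃ U : X p, enc U = f := by
  set w : F := restr (ev f) with hw
  have hev : w =ᵐ[μ] fun x => 1 / 2 * (restr f x + restr (refl f) x) := by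
    filter_upwards [coeFn_restr_ev f, coeFn_restr f, coeFn_restr_refl f] with x e1 e2 e3
    rw [hw, e1, e2, e3]
  have hod : restr (od f) =ᵐ[μ] fun x => 1 / 2 * (restr f x - restr (refl f) x) := by
    filter_upwards [coeFn_restr_od f, coeFn_restr f, coeFn_restr_refl f] with x e1 e2 e3
    rw [e1, e2, e3]
  have hwp : MemLp w p μ := ((h1.add h2).const_mul (1 / 2)).ae_eq hev.symm
  have hvp : MemLp (restr (od f)) p μ := ((h1.sub h2).const_mul (1 / 2)).ae_eq hod.symm
  -- Cutting off outside `(0,1)` makes the primitive `u` constant on each side; the constant on the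
  -- right is `ell 1 f`, half the mean of `f`, hence zero.
  let g : ℝ → ℝ := (Set.Ioo (0 : ℝ) 1).indicator w
  have hg : Integrable g volume := (integrable_indicator_iff measurableSet_Ioo).2
    (L1.integrable_coeFn w)
  have hgw : w =ᵐ[μ] g := (ae_restrict_iff' measurableSet_Ioo).2
    (.of_forall fun x hx => (Set.indicator_of_mem hx _).symm)
  let u : ℝ → ℝ := fun x => ∫ y in (0 : ℝ)..x, g y
  have hu1 : ∀ x ∈ Set.Icc (0 : ℝ) 1, u x = ell x f := fun x hx => (ell_eq_integral hx hgw).symm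
  have hu0 : ∀ x, x ∉ Set.Ioo (0 : ℝ) 1 → u x = 0 := by
    intro x hx
    rcases le_or_gt x 0 with h | h
    · refine intervalIntegral.integral_zero_ae (.of_forall fun y hy => ?_)
      rw [Set.uIoc_of_ge h] at hy
      exact Set.indicator_of_notMem (fun hy' => absurd hy'.1 (not_lt.2 hy.2)) _
    · have hx1 : 1 ≤ x := not_lt.1 fun h' => hx ⟨h, h'⟩
      have e1 : ∫ y in (1 : ℝ)..x, g y = 0 := by
        refine intervalIntegral.integral_zero_ae (.of_forall fun y hy => ?_)
        rw [Set.uIoc_of_le hx1] at hy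
        exact Set.indicator_of_notMem (fun hy' => absurd hy'.2 (not_lt.2 hy.1.le)) _
      have e2 : u 1 = 0 := by
        have := mean_eq_ell f
        rw [hm] at this
        rw [hu1 1 ⟨zero_le_one, le_rfl⟩]
        linarith
      simp only [u] at e2 ⊢
      rw [← intervalIntegral.integral_add_adjacent_intervals (hg.intervalIntegrable (a := 0) (b := 1))
        hg.intervalIntegrable, e1, e2, add_zero]
  have hd : deriv u =ᵐ[μ] w := by
    have := (hg.intervalIntegrable (a := 0) (b := 1)).ae_hasDerivAt_integral
    rw [Set.uIcc_of_le zero_le_one] at this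
    filter_upwards [ae_restrict_of_ae this, ae_restrict_mem measurableSet_Ioo, hgw] with x h hx h'
    rw [h']
    exact (h ⟨hx.1.le, hx.2.le⟩ 0 ⟨le_rfl, zero_le_one⟩).deriv
  have hW : u ∈ W0 p := ⟨hg.intervalIntegrable.absolutelyContinuousOnInterval_intervalIntegral
    (by simp), hu0, hwp.ae_eq hd.symm⟩
  let U : X p := (⟨u, hW⟩, hvp.toLp _)
  have hvel : X.vel U =ᵐ[μ] restr (od f) := hvp.coeFn_toLp
  have hder : deriv (X.pos U) =ᵐ[μ] w := hd
  refine ⟨U, ext_restr (Lp.ext ?_) (Lp.ext ?_)⟩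
  · filter_upwards [restr_enc U, hvel, hder, hev, hod] with x e1 e2 e3 e4 e5
    rw [e1, X.rho, e2, e3, e4, e5]
    ring
  · filter_upwards [restr_refl_enc U, hvel, hder, hev, hod] with x e1 e2 e3 e4 e5
    rw [e1, X.xi, e2, e3, e4, e5]
    ring

end Encoding

/-! ### The norms of `X_1` and `X_∞` as gauges. -/

/-- The condition on `f` which corresponds to `‖U‖ ≤ c` for states `U` in `X_1` or `X_∞`. -/
def gauge (p : ℝ≥0∞) (c : ℝ) (f : E) : Prop :=
  if p = ∞ then ∀ᵐ x, |f x| ≤ c else ‖f‖ ≤ c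

lemma isGauge_gauge (p : ℝ≥0∞) : IsGauge (gauge p) := by
  by_cases hp : p = ∞
  · have : gauge p = fun c f => ∀ᵐ x, |f x| ≤ c := by
      funext c f
      simp only [gauge, if_pos hp]
    rw [this]
    exact isGauge_bdd
  · have : gauge p = fun c f => ‖f‖ ≤ c := by
      funext c f
      simp only [gauge, if_neg hp]
    rw [this]
    exact isGauge_norm

lemma gauge_mono {p : ℝ≥0∞} {c c' : ℝ} {f : E} (h : gauge p c f) (hc : c ≤ c') :
    gauge p c' f := by
  unfold gauge at h ⊢
  split_ifs at h ⊢ with hp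
  · exact h.mono fun x hx => hx.trans hc
  · exact h.trans hc

lemma ae_bdd_circ_iff (c : ℝ) (f : E) : (∀ᵐ x, |f x| ≤ c) ↔
    (∀ᵐ y ∂μ, |restr f y| ≤ c) ∧ ∀ᵐ y ∂μ, |restr (refl f) y| ≤ c := by
  rw [ae_circ_iff (measurableSet_le (Lp.stronglyMeasurable f).measurable.abs measurable_const)]
  refine and_congr ?_ ?_
  · refine eventually_congr ?_
    filter_upwards [coeFn_restr f] with y h
    rw [h]
  · refine eventually_congr ?_
    filter_upwards [coeFn_restr_refl f] with y h
    rw [h]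

lemma toReal_eLpNorm_top_le_iff {g : ℝ → ℝ} (hg : MemLp g ∞ μ) {c : ℝ} (hc : 0 ≤ c) :
    (eLpNorm g ∞ μ).toReal ≤ c ↔ ∀ᵐ y ∂μ, |g y| ≤ c := by
  rw [← ENNReal.le_ofReal_iff_toReal_le hg.2.ne hc, eLpNorm_exponent_top]
  constructor
  · intro h
    filter_upwards [ae_le_eLpNormEssSup (f := g) (μ := μ)] with y hy
    have := hy.trans h
    rwa [← ofReal_norm, ENNReal.ofReal_le_ofReal_iff hc] at this
  · intro h
    exact eLpNormEssSup_le_of_ae_bound h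

lemma Xnorm_one (U : X 1) : Xnorm U = ‖enc U‖ := by
  have h1 : ‖restr (enc U)‖ = ∫ x, |X.rho U x| ∂μ := by
    rw [L1.norm_eq_integral_norm]
    refine integral_congr_ae ?_
    filter_upwards [restr_enc U] with x hx
    rw [hx, Real.norm_eq_abs]
  have h2 : ‖restr (refl (enc U))‖ = ∫ x, |X.xi U x| ∂μ := by
    rw [L1.norm_eq_integral_norm]
    refine integral_congr_ae ?_
    filter_upwards [restr_refl_enc U] with x hx
    rw [hx, Real.norm_eq_abs]
  rw [norm_split, h1, h2, ← integral_add (memLp_one_iff_integrable.1 U.memLp_rho).abs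
    (memLp_one_iff_integrable.1 U.memLp_xi).abs, Xnorm, if_neg ENNReal.one_ne_top]
  simp

lemma Xnorm_nonneg {p : ℝ≥0∞} (U : X p) : 0 ≤ Xnorm U := by
  unfold Xnorm
  split_ifs
  · exact le_max_of_le_left ENNReal.toReal_nonneg
  · refine Real.rpow_nonneg (mul_nonneg (by positivity) ?_) _
    exact integral_nonneg fun x => by positivity

lemma Xnorm_le_iff {p : ℝ≥0∞} [hp1 : Fact (1 ≤ p)] (hp : p = 1 ∨ p = ∞) (U : X p) {c : ℝ}
    (hc : 0 ≤ c) : Xnorm U ≤ c ↔ gauge p c (enc U) := by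
  rcases hp with rfl | rfl
  · rw [gauge, if_neg ENNReal.one_ne_top, Xnorm_one]
  · rw [gauge, if_pos rfl, Xnorm, if_pos rfl, max_le_iff,
      toReal_eLpNorm_top_le_iff U.memLp_rho hc, toReal_eLpNorm_top_le_iff U.memLp_xi hc,
      ae_bdd_circ_iff]
    refine and_congr ?_ ?_
    · refine eventually_congr ?_
      filter_upwards [restr_enc U] with y h
      rw [h]
    · refine eventually_congr ?_
      filter_upwards [restr_refl_enc U] with y h
      rw [h]

lemma exists_enc_eq_of_gauge {p : ℝ≥0∞} [hp1 : Fact (1 ≤ p)] (hp : p = 1 ∨ p = ∞) {f : E} {c : ℝ}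
    (hm : mean f = 0) (hf : gauge p c f) : ∃ U : X p, enc U = f := by
  rcases hp with rfl | rfl
  · exact exists_enc_eq hm (Lp.memLp _) (Lp.memLp _)
  · rw [gauge, if_pos rfl, ae_bdd_circ_iff] at hf
    exact exists_enc_eq hm
      (memLp_top_of_bound (Lp.stronglyMeasurable _).aestronglyMeasurable c hf.1)
      (memLp_top_of_bound (Lp.stronglyMeasurable _).aestronglyMeasurable c hf.2)


/-! ### Odd periodic extensions and d'Alembert's formula on the circle. -/

lemma coe_sub_two_mul_int (y : ℝ) (n : ℤ) : ((y - 2 * (n : ℝ) : ℝ) : Circ) = (y : Circ) := by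
  have : ((2 * (n : ℝ) : ℝ) : Circ) = 0 := by
    rw [AddCircle.coe_eq_zero_iff]
    exact ⟨n, by rw [zsmul_eq_mul, mul_comm]⟩
  rw [AddCircle.coe_sub, this, sub_zero]

lemma sub_floor_mem (x : ℝ) : x - 2 * (⌊(x + 1) / 2⌋ : ℝ) ∈ Set.Ico (-1 : ℝ) 1 := by
  have h1 := Int.floor_le ((x + 1) / 2)
  have h2 := Int.lt_floor_add_one ((x + 1) / 2)
  constructor <;> linarith

lemma oddExt_ae_eq {f : E} {g : ℝ → ℝ} (hf : refl f = -f) (hg : restr f =ᵐ[μ] g) :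
    oddExt g =ᵐ[volume] fun y => f (y : Circ) := by
  let P : ℝ → Prop := fun y => y ∈ Set.Ioo (0 : ℝ) 1 →
    f (y : Circ) = g y ∧ f ((-y : ℝ) : Circ) = -g y
  have hP : ∀ᵐ y : ℝ, P y := by
    refine (ae_restrict_iff' measurableSet_Ioo).1 ?_
    have h := coeFn_restr_refl f
    rw [hf, map_neg] at h
    filter_upwards [hg, coeFn_restr f, h, Lp.coeFn_neg (restr f)] with y h1 h2 h3 h4
    rw [← h2, ← h3, h4, Pi.neg_apply, h1]
    exact ⟨rfl, rfl⟩
  -- The shift in `oddExt` depends on `y`, so the exceptional null sets of all integer shifts are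
  -- removed together, along with the points that reduce to `0` or `-1`.
  have hshift : ∀ n : ℤ, ∀ᵐ y : ℝ, P (y - 2 * (n : ℝ)) ∧ P (-(y - 2 * (n : ℝ))) ∧
      y - 2 * (n : ℝ) ≠ 0 ∧ y - 2 * (n : ℝ) ≠ -1 := by
    intro n
    have q := (measurePreserving_sub_right (volume : Measure ℝ)
      (2 * (n : ℝ))).quasiMeasurePreserving
    have q' := (Measure.measurePreserving_neg (volume : Measure ℝ)).quasiMeasurePreserving
    filter_upwards [q.ae hP, q.ae (q'.ae hP), q.ae (Measure.ae_ne volume 0),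
      q.ae (Measure.ae_ne volume (-1))] with y h1 h2 h3 h4
    exact ⟨h1, h2, h3, h4⟩
  filter_upwards [ae_all_iff.2 hshift] with y hy
  obtain ⟨h1, h2, h3, h4⟩ := hy ⌊(y + 1) / 2⌋
  have hmem := sub_floor_mem y
  rw [← coe_sub_two_mul_int y ⌊(y + 1) / 2⌋]
  simp only [oddExt]
  set z := y - 2 * (⌊(y + 1) / 2⌋ : ℝ)
  split_ifs with hz
  · exact (h1 ⟨lt_of_le_of_ne hz (Ne.symm h3), hmem.2⟩).1.symm
  · have := (h2 ⟨by linarith [not_le.1 hz], by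
      have := lt_of_le_of_ne hmem.1 (Ne.symm h4)
      linarith⟩).2
    rw [neg_neg] at this
    exact this.symm

lemma oddExt_eq {u N : ℝ → ℝ} (hper : Function.Periodic N 2) (hodd : ∀ y, N (-y) = -N y)
    (h : ∀ y ∈ Set.Icc (0 : ℝ) 1, N y = u y) : oddExt u = N := by
  funext x
  have hmem := sub_floor_mem x
  have hN : N x = N (x - 2 * (⌊(x + 1) / 2⌋ : ℝ)) := by
    rw [mul_comm]
    exact (hper.sub_int_mul_eq _).symm
  rw [hN]
  simp only [oddExt]
  set z := x - 2 * (⌊(x + 1) / 2⌋ : ℝ)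
  split_ifs with hz
  · exact (h z ⟨hz, hmem.2.le⟩).symm
  · rw [← h (-z) ⟨by linarith [not_le.1 hz], by linarith [hmem.1]⟩, hodd, neg_neg]

lemma oddExt_const_mul (c : ℝ) (g : ℝ → ℝ) (y : ℝ) :
    oddExt (fun r => c * g r) y = c * oddExt g y := by
  simp only [oddExt]
  split_ifs <;> ring

lemma integral_neg_of_refl {f : E} {c : ℝ} (hf : refl f = c • f) (y : ℝ) :
    ∫ r in (0 : ℝ)..(-y), f (r : Circ) = -c * ∫ r in (0 : ℝ)..y, f (r : Circ) := by
  have h1 := intervalIntegral.integral_comp_neg (a := 0) (b := y) (fun r : ℝ => f (r : Circ))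
  have h2 : ∫ r in (0 : ℝ)..y, f ((-r : ℝ) : Circ) = c * ∫ r in (0 : ℝ)..y, f (r : Circ) := by
    rw [← intervalIntegral.integral_const_mul]
    refine intervalIntegral.integral_congr_ae ?_
    have h3 := coeFn_refl f
    rw [hf] at h3
    filter_upwards [quasiMeasurePreserving_coe.ae h3,
      quasiMeasurePreserving_coe.ae (Lp.coeFn_smul c f)] with r e1 e2 _
    rw [AddCircle.coe_neg, ← e1, e2, Pi.smul_apply, smul_eq_mul]
  rw [intervalIntegral.integral_symm, neg_mul, ← h2, h1, neg_zero]

variable {p : ℝ≥0∞} [hp1 : Fact (1 ≤ p)]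

/-- The primitive from `0` of an even function is odd, and mean zero makes it `2`-periodic; on
`[0,1]` it is the displacement. -/
lemma oddExt_pos (U : X p) (y : ℝ) :
    oddExt (X.pos U) y = ∫ r in (0 : ℝ)..y, ev (enc U) (r : Circ) := by
  refine congrFun (oddExt_eq (N := fun y => ∫ r in (0 : ℝ)..y, ev (enc U) (r : Circ))
    (fun y => ?_) (fun y => ?_) fun y hy => ?_) y
  · have i := intervalIntegrable_coe (ev (enc U))
    have h := integral_period (ev (enc U)) y
    have hm : mean (ev (enc U)) = 0 := by
      rw [mean_eq_ell, ell_ev, ← mean_eq_ell, mean_enc]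
    rw [hm, ← intervalIntegral.integral_interval_sub_left (i 0 (y + 2)) (i 0 y)] at h
    exact sub_eq_zero.1 h
  · have := integral_neg_of_refl (f := ev (enc U)) (c := 1) (by rw [refl_ev, one_smul]) y
    simpa using this
  · rw [← ell_enc hy, ell_eq_integral hy (coeFn_restr (ev (enc U)))]

lemma integral_od_symm (f : E) (x t : ℝ) :
    ∫ y in (t - x)..(t + x), od f (y : Circ) = ∫ y in (x - t)..(x + t), od f (y : Circ) := by
  have i := intervalIntegrable_coe (od f)
  have h := integral_neg_of_refl (f := od f) (c := -1) (by rw [refl_od, neg_one_smul]) (x - t)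
  rw [neg_neg, one_mul, neg_sub] at h
  rw [← intervalIntegral.integral_interval_sub_left (i 0 (t + x)) (i 0 (t - x)), h,
    ← intervalIntegral.integral_interval_sub_left (i 0 (x + t)) (i 0 (x - t)), add_comm t x]

lemma integral_oddExt_vel (U : X p) (a b : ℝ) :
    ∫ y in a..b, oddExt (X.vel U) y = ∫ y in a..b, od (enc U) (y : Circ) :=
  intervalIntegral.integral_congr_ae
    ((oddExt_ae_eq (refl_od _) (restr_od_enc U)).mono fun _ h _ => h)

lemma ell_tr_od_enc {x : ℝ} (hx : x ∈ Set.Icc (0 : ℝ) 1) (t : ℝ) (U : X p) :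
    ell x (tr t (od (enc U))) = 1 / 2 * ∫ y in (x - t)..(x + t), oddExt (X.vel U) y := by
  rw [ell_tr hx, integral_od_symm, integral_oddExt_vel]

/-- The undamped d'Alembert formula: free waves are translations on the circle, with the even part
contributing the `z₀` terms and the odd part the `z₁` integral. -/
lemma ell_tr_enc {x : ℝ} (hx : x ∈ Set.Icc (0 : ℝ) 1) (t : ℝ) (U : X p) :
    ell x (tr t (enc U)) =
      1 / 2 * (oddExt (X.pos U) (x + t) + oddExt (X.pos U) (x - t))
      + 1 / 2 * ∫ y in (x - t)..(x + t), oddExt (X.vel U) y := by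
  have i := intervalIntegrable_coe (ev (enc U))
  have h := integral_neg_of_refl (f := ev (enc U)) (c := 1) (by rw [refl_ev, one_smul]) (x - t)
  rw [neg_sub] at h
  conv_lhs => rw [← ev_add_od (enc U)]
  rw [map_add, map_add, ell_tr_od_enc hx, ell_tr hx, oddExt_pos, oddExt_pos,
    ← intervalIntegral.integral_interval_sub_left (i 0 (t + x)) (i 0 (t - x)), h, add_comm t x]
  ring

/-- d'Alembert's formula in terms of functions on the circle. -/
lemma dalembert_eq_ell {α : ℝ} {x : ℝ} (hx : x ∈ Set.Icc (0 : ℝ) 1) (U₀ : X p) (Z : ℝ≥0 → X p)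
    {v : ℝ → E} (hv : Continuous v) (hvZ : ∀ s : ℝ, 0 ≤ s → v s = od (enc (Z s.toNNReal)))
    {t : ℝ} (ht : 0 ≤ t) :
    (1 / 2) * (oddExt (X.pos U₀) (x + t) + oddExt (X.pos U₀) (x - t))
      + (1 / 2) * (∫ y in (x - t)..(x + t), oddExt (X.vel U₀) y)
      + (1 / 2) * (∫ s in (0 : ℝ)..t, ∫ y in (x - (t - s))..(x + (t - s)),
          oddExt (fun r => -(2 * α * X.vel (Z s.toNNReal) r)) y) =
    ell x (duhamel α (enc U₀) v t) := by
  rw [ell_duhamel hv, ell_tr_enc hx, sub_eq_add_neg (_ + _), ← neg_mul,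
    ← intervalIntegral.integral_const_mul (-(2 * α)),
    ← intervalIntegral.integral_const_mul (1 / 2 : ℝ) (fun s => ∫ y in _.._, _)]
  congr 1
  refine intervalIntegral.integral_congr fun s hs => ?_
  rw [Set.uIcc_of_le ht] at hs
  rw [hvZ s hs.1, ell_tr_od_enc hx]
  simp only [← neg_mul, oddExt_const_mul]
  rw [intervalIntegral.integral_const_mul]
  ring

/-! ### Weak solutions are the evolution on the circle; conclusion. -/

lemma eLpNorm_vel_sub (U V : X p) : eLpNorm (fun x => X.vel U x - X.vel V x) 1 μ =
    ENNReal.ofReal (‖od (enc U) - od (enc V)‖ / 2) := by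
  have h : ‖od (enc U) - od (enc V)‖ / 2 = ‖restr (od (enc U) - od (enc V))‖ := by
    rw [norm_split, map_sub refl, refl_od, refl_od, neg_sub_neg, ← neg_sub (od (enc U)), map_neg,
      norm_neg]
    ring
  rw [h, Lp.norm_def, ENNReal.ofReal_toReal (Lp.memLp _).2.ne]
  refine eLpNorm_congr_ae ?_
  rw [map_sub]
  filter_upwards [restr_od_enc U, restr_od_enc V,
    Lp.coeFn_sub (restr (od (enc U))) (restr (od (enc V)))] with x h1 h2 h3
  rw [h3, Pi.sub_apply, h1, h2]

lemma eLpNorm_slope (U V W : X p) (s t : ℝ) :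
    eLpNorm (fun x => (X.pos U x - X.pos V x) / (s - t) - X.vel W x) 1 μ =
    ENNReal.ofReal ‖(s - t)⁻¹ • (displ (enc U) - displ (enc V)) - restr (od (enc W))‖ := by
  rw [Lp.norm_def, ENNReal.ofReal_toReal (Lp.memLp _).2.ne]
  refine eLpNorm_congr_ae ?_
  filter_upwards [restr_od_enc W, displ_enc U, displ_enc V,
    Lp.coeFn_sub (displ (enc U)) (displ (enc V)),
    Lp.coeFn_smul (s - t)⁻¹ (displ (enc U) - displ (enc V)),
    Lp.coeFn_sub ((s - t)⁻¹ • (displ (enc U) - displ (enc V))) (restr (od (enc W)))]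
    with x h1 h2 h3 h4 h5 h6
  rw [h6, Pi.sub_apply, h5, Pi.smul_apply, h4, Pi.sub_apply, h1, h2, h3, smul_eq_mul]
  ring

lemma tendsto_ofReal_norm_iff {Y V : Type*} [NormedAddCommGroup V] {l : Filter Y} {g : Y → V} :
    Tendsto (fun y => ENNReal.ofReal ‖g y‖) l (𝓝 0) ↔ Tendsto g l (𝓝 0) := by
  rw [tendsto_zero_iff_norm_tendsto_zero (f := g)]
  constructor
  · intro h
    have := (ENNReal.tendsto_toReal ENNReal.zero_ne_top).comp h
    simpa [Function.comp_def] using this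
  · intro h
    have := ENNReal.tendsto_ofReal h
    rwa [ENNReal.ofReal_zero] at this

lemma tendsto_coe_nhdsNE (t : ℝ≥0) : Tendsto (fun s : ℝ≥0 => (s : ℝ)) (𝓝[≠] t) (𝓝[≠] (t : ℝ)) :=
  tendsto_nhdsWithin_of_tendsto_nhds_of_eventually_within _
    ((NNReal.continuous_coe.tendsto t).mono_left nhdsWithin_le_nhds)
    (eventually_mem_nhdsWithin.mono fun _ hs h => hs (NNReal.coe_injective h))

instance neBot_nhdsNE_nnreal (t : ℝ≥0) : (𝓝[≠] t).NeBot := by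
  have h : (𝓝[>] t).NeBot := inferInstance
  exact h.mono (nhdsWithin_mono t fun s hs => ne_of_gt hs)

/-- Gives existence and uniqueness at once, `enc` being injective. Forwards, the even and odd parts
of the state are identified separately with those of the Duhamel state; backwards, each defining
property is read off from `evo_eq_duhamel`. -/
lemma isWeakSolution_iff {α : ℝ} (hα : 0 ≤ α) (hp : p = 1 ∨ p = ∞) (U₀ : X p) (Z : ℝ≥0 → X p) :
    IsWeakSolution (fun _ => 2 * α) U₀ Z ↔ ∀ t : ℝ≥0, enc (Z t) = evo α (enc U₀) t := by
  constructor
  · intro h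
    let v : ℝ → E := fun s => od (enc (Z s.toNNReal))
    have hv : Continuous v := by
      have : Continuous fun t : ℝ≥0 => od (enc (Z t)) := by
        refine continuous_iff_continuousAt.2 fun t => ?_
        have h1 := h.continuous_vel t
        simp only [eLpNorm_vel_sub] at h1
        have h2 : ∀ s, ‖od (enc (Z s)) - od (enc (Z t))‖ / 2 =
            ‖(1 / 2 : ℝ) • (od (enc (Z s)) - od (enc (Z t)))‖ := fun s => by
          rw [norm_smul]
          norm_num
          ring
        simp only [h2] at h1
        rw [tendsto_ofReal_norm_iff] at h1
        have h3 := (h1.const_smul (2 : ℝ)).add_const (od (enc (Z t)))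
        rw [smul_zero, zero_add] at h3
        refine h3.congr fun s => ?_
        module
      exact this.comp continuous_real_toNNReal
    let r : ℝ → E := fun s => enc (Z s.toNNReal)
    -- d'Alembert's formula only sees displacements, hence only even parts.
    have hell : ∀ t : ℝ, 0 ≤ t → ∀ x ∈ Set.Icc (0 : ℝ) 1,
        ell x (r t) = ell x (duhamel α (enc U₀) v t) := by
      intro t ht x hx
      have h1 := h.dalembert t.toNNReal x hx
      rw [Real.coe_toNNReal t ht] at h1
      rw [← dalembert_eq_ell hx U₀ Z hv (fun s _ => rfl) ht, ← h1, ell_enc hx]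
    have hodd : ∀ s, refl (v s) = -v s := fun s => refl_od _
    have hdispl : ∀ t : ℝ, 0 ≤ t → displ (r t) = displ (duhamel α (enc U₀) v t) := by
      intro t ht
      refine Lp.ext ?_
      filter_upwards [coeFn_displ (r t), coeFn_displ (duhamel α (enc U₀) v t),
        ae_restrict_mem measurableSet_Ioo] with x h1 h2 hx
      rw [h1, h2, hell t ht x ⟨hx.1.le, hx.2.le⟩]
    -- The two displacements agree at all times, so their time derivatives in `L^1` agree; these are
    -- the two odd parts.
    have hod : ∀ t : ℝ≥0, restr (od (enc (Z t))) = restr (od (duhamel α (enc U₀) v t)) := by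
      intro t
      have h1 := h.hasDeriv t
      simp only [eLpNorm_slope] at h1
      rw [tendsto_ofReal_norm_iff] at h1
      have h2 := (hasDerivAt_iff_tendsto_slope.1
        (hasDerivAt_displ_duhamel (α := α) (f := enc U₀) hv hodd t)).comp (tendsto_coe_nhdsNE t)
      refine tendsto_nhds_unique ?_ h2
      have h3 := h1.add_const (restr (od (enc (Z t))))
      rw [zero_add] at h3
      refine h3.congr fun s => ?_
      have e : ∀ s : ℝ≥0, displ (enc (Z s)) = displ (duhamel α (enc U₀) v s) := fun s => by
        rw [← hdispl s s.coe_nonneg]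
        simp only [r, Real.toNNReal_coe]
      rw [sub_add_cancel, e, e, Function.comp_apply, slope_def_module]
    have hr : ∀ t : ℝ, 0 ≤ t → r t = duhamel α (enc U₀) v t := by
      intro t ht
      refine ext_ev_od (restr_ev_eq_of_ell (hell t ht)) ?_
      have := hod t.toNNReal
      rwa [Real.coe_toNNReal t ht] at this
    intro t
    have := eq_evo_of_duhamel hα hv (fun s _ => rfl) hr t.coe_nonneg
    simpa only [r, Real.toNNReal_coe] using this
  · intro h
    let v : ℝ → E := fun s => od (evo α (enc U₀) s)
    have hv : Continuous v := od.continuous.comp (continuous_evo hα)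
    have hodd : ∀ s, refl (v s) = -v s := fun s => refl_od _
    refine ⟨⟨Xnorm U₀, fun t => ?_⟩, fun t => ?_, fun t => ?_, fun t x hx => ?_⟩
    · rw [Xnorm_le_iff hp _ (Xnorm_nonneg U₀), h]
      exact (isGauge_gauge p).evo hα ((Xnorm_le_iff hp _ (Xnorm_nonneg U₀)).1 le_rfl) t.coe_nonneg
    · simp only [eLpNorm_slope]
      rw [tendsto_ofReal_norm_iff]
      have h2 := (hasDerivAt_iff_tendsto_slope.1
        (hasDerivAt_displ_duhamel (α := α) (f := enc U₀) hv hodd t)).comp (tendsto_coe_nhdsNE t)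
      have h3 := h2.sub_const (restr (od (enc (Z t))))
      have e : ∀ s : ℝ≥0, duhamel α (enc U₀) v s = enc (Z s) := fun s => by
        rw [h, evo_eq_duhamel hα]
      rw [e, sub_self] at h3
      refine h3.congr fun s => ?_
      rw [Function.comp_apply, slope_def_module, e, e]
    · simp only [eLpNorm_vel_sub, h]
      have hc : Continuous fun s : ℝ≥0 => ENNReal.ofReal (‖v s - v t‖ / 2) :=
        ENNReal.continuous_ofReal.comp
          (((hv.comp NNReal.continuous_coe).sub continuous_const).norm.div_const 2)
      have := hc.tendsto t
      simpa using this
    · rw [dalembert_eq_ell (α := α) hx U₀ Z hv (fun s hs => by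
        rw [h, Real.coe_toNNReal s hs]) t.coe_nonneg, ← evo_eq_duhamel hα, ← h, ell_enc hx]

theorem exists_stable_waveSemigroup {α : ℝ} (hα : 0 < α) (hp : p = 1 ∨ p = ∞) :
    ∃ S : ℝ≥0 → (X p →ₗ[ℝ] X p),
      IsWaveSemigroup (fun _ => 2 * α) S ∧ IsExponentiallyStable S := by
  have hα0 : 0 ≤ α := hα.le
  have hex : ∀ (t : ℝ≥0) (U : X p), ∃ V : X p, enc V = evo α (enc U) t := fun t U =>
    exists_enc_eq_of_gauge hp (mean_evo hα0 (mean_enc U) t.coe_nonneg)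
      ((isGauge_gauge p).evo hα0 ((Xnorm_le_iff hp _ (Xnorm_nonneg U)).1 le_rfl) t.coe_nonneg)
  choose S₀ hS₀ using hex
  let S : ℝ≥0 → (X p →ₗ[ℝ] X p) := fun t =>
    { toFun := S₀ t
      map_add' := fun U V => enc_injective (by
        rw [map_add, hS₀, hS₀, hS₀, map_add, evo_add_left hα0 _ _ t.coe_nonneg])
      map_smul' := fun c U => enc_injective (by
        rw [RingHom.id_apply, map_smul, hS₀, hS₀, map_smul, evo_smul_left hα0 _ _ t.coe_nonneg]) }
  have hS : ∀ t U, enc (S t U) = evo α (enc U) t := hS₀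
  refine ⟨S, ⟨?_, ?_, ?_, ?_⟩, ?_⟩
  · refine LinearMap.ext fun U => enc_injective ?_
    rw [hS, NNReal.coe_zero, evo_zero, LinearMap.id_apply]
  · intro s t
    refine LinearMap.ext fun U => enc_injective ?_
    rw [hS, LinearMap.comp_apply, hS, hS, NNReal.coe_add, evo_add hα0 _ s.coe_nonneg]
  · intro U₀ Z
    rw [isWeakSolution_iff hα0 hp]
    constructor
    · intro h
      funext t
      exact enc_injective (by rw [h, hS])
    · rintro rfl t
      exact hS t U₀
  · intro hpt U₀ t
    -- Here the norm of `X_1` is the `L^1` norm on the circle, in which `evo` is continuous.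
    obtain rfl : p = 1 := hp.resolve_right hpt
    have hc : Continuous fun s : ℝ≥0 => ‖evo α (enc U₀) s - evo α (enc U₀) t‖ :=
      (((continuous_evo hα0).comp NNReal.continuous_coe).sub continuous_const).norm
    have := hc.tendsto t
    rw [sub_self, norm_zero] at this
    refine this.congr fun s => ?_
    rw [Xnorm_one, map_sub, hS, hS]
  · obtain ⟨C, γ, hC, hγ, hdec⟩ := exists_decay hα
    refine ⟨C, γ, hC, hγ, fun t U => ?_⟩
    obtain ⟨c, hc, hg⟩ := hdec (gauge p) (isGauge_gauge p) (Xnorm U) (enc U) t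
      ((Xnorm_le_iff hp _ (Xnorm_nonneg U)).1 le_rfl) (Xnorm_nonneg U) (mean_enc U) t.coe_nonneg
    rw [Xnorm_le_iff hp _ (mul_nonneg (mul_nonneg hC.le (Real.exp_pos _).le) (Xnorm_nonneg U)), hS]
    exact gauge_mono hg hc

end DampedWave

end

theorem proposition5p1 (α : ℝ) (hα : α ∈ Set.Ioo (0 : ℝ) 2) (p : ℝ≥0∞) (hp : p = 1 ∨ p = ∞) :
    ∃ S : ℝ≥0 → (DampedWave.X p →ₗ[ℝ] DampedWave.X p),
      DampedWave.IsWaveSemigroup (fun _ => 2 * α) S ∧ DampedWave.IsExponentiallyStable S := by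
  have hp1 : Fact (1 ≤ p) := ⟨by rcases hp with rfl | rfl <;> simp⟩
  exact DampedWave.exists_stable_waveSemigroup hα.1 hp
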